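/- Let $n,m\ge 0$ be integers, and let $E$ and $A'$ be finite-dimensional quantum systems. Let $\rho_{AE}=\sum_{a\in\{0,1\}^n}|a\rangle\langle a|_A\otimes\rho_E^{a}$ be a nonzero sub-normalized classical-quantum state ($\rho_E^a\ge 0$, $\sum_a\mathrm{Tr}\,\rho_E^a\le 1$), where $A$ is an $n$-qubit system, and let $|\Psi\rangle_{AEA'}$ be any purification of it, $\mathrm{Tr}_{A'}|\Psi\rangle\langle\Psi|=\rho_{AE}$. Let $G$ be a random hash function: a finite family of linear surjective maps $g:\{0,1\}^n\to\{0,1\}^m$ over $\mathbb F_2$ with probabilities $\Pr(G=g)$. Assume that $G$ is universal$_2$: $\Pr(G(a)=G(a'))\le 2^{-m}$ for all $a\ne a'$. *Secrecy measure.* Put $\rho_E=\sum_a\rho_E^a$ and $$\rho^{\rm fin}_{KEG}=\sum_g\Pr(G=g)\sum_{k\in\{0,1\}^m}|k\rangle\langle k|_K\otimes\Big(\sum_{a\in g^{-1}(k)}\rho_E^a\Big)\otimes|g\rangle\langle g|_G,$$ $$\rho^{\rm ideal}_{KEG}=\sum_g\Pr(G=g)\,2^{-m}\sum_k|k\rangle\langle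 k|_K\otimes\rho_E\otimes|g\rangle\langle g|_G,$$ and $d_1(\rho^{\rm fin}_{KEG})=\|\rho^{\rm fin}_{KEG}-\rho^{\rm ideal}_{KEG}\|_1$, where $\|M\|_1=\mathrm{Tr}\sqrt{M^\dagger M}$. *Min-entropy.* $H_{\min}(\rho_{AE}|E)$ is the maximum real $\lambda$ such that $2^{-\lambda}\,\mathbb I_A\otimes\sigma_E\ge\rho_{AE}$ for some normalized state $\sigma_E$. *Phase error correction (PEC).* For each $g$ fix a check matrix $h\in\mathbb F_2^{(n-m)\times n}$ of the code $(\ker g)^\perp$, with rows $h_1,\dots,h_{n-m}$. The PEC for $g$ (i) measures the commuting operators $X^{h_1},\dots,X^{h_{n-m}}$ on $A$, with outcome eigenvalues $(-1)^{s_j}$, $s\in\{0,1\}^{n-m}$; (ii) measures $A'$ with operators $\{E^{g,s,e}\}_{e\in\{0,1\}^n}$, $\sum_e E^{g,s,e\,\dagger}E^{g,s,e}=\mathbb I_{A'}$, with outcome $e$; (iii) applies $Z^e$ to $A$. Let $\rho^{{\rm pec},g}$ be its output on $|\Psi\rangle\langle\Psi|$, and let $$P^{\rm ph}_A(\rho^{{\rm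 pec},g})=\mathrm{Tr}\,\rho^{{\rm pec},g}_A-\langle\widetilde 0|\rho_A^{{\rm pec},g}|\widetilde 0\rangle,\qquad |\widetilde 0\rangle=2^{-n/2}\sum_z|z\rangle,$$ be its failure probability (equal to $1-\langle\widetilde 0|\rho_A^{{\rm pec},g}|\widetilde 0\rangle$ in the normalized case). Then, for every choice of the ancilla measurements $\{E^{g,s,e}\}$, $$d_1(\rho^{\rm fin}_{KEG})\le 2\sqrt2\,\sqrt{\sum_g\Pr(G=g)\,P^{\rm ph}_A(\rho^{{\rm pec},g})},$$ and there is a choice of the ancilla measurements for which moreover $$2\sqrt2\,\sqrt{\sum_g\Pr(G=g)\,P^{\rm ph}_A(\rho^{{\rm pec},g})}\le 2\sqrt2\cdot 2^{\frac12[m-H_{\min}(\rho_{AE}|E)]}=2^{\frac12[m-H_{\min}(\rho_{AE}|E)+3]}.$$ -/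

import Mathlib

open scoped Matrix Kronecker MatrixOrder ComplexOrder

noncomputable section

namespace PhaseEC

/-- Bit strings of length `n`, with arithmetic modulo 2. -/
abbrev Bits (n : ℕ) : Type := Fin n → ZMod 2

/-- `(-1)^b`. -/
def sgn (b : ZMod 2) : ℂ := (-1) ^ b.val

/-- The Pauli operator `Z^z = ⊗ᵢ Z^{zᵢ}`: `Z^z |a⟩ = (-1)^{z·a} |a⟩`. -/
def pauliZ {n : ℕ} (z : Bits n) : Matrix (Bits n) (Bits n) ℂ :=
  Matrix.diagonal fun a => sgn (z ⬝ᵥ a)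

/-- The Pauli operator `X^x = ⊗ᵢ X^{xᵢ}`: `X^x |a⟩ = |a + x⟩`. -/
def pauliX {n : ℕ} (x : Bits n) : Matrix (Bits n) (Bits n) ℂ :=
  Matrix.of fun b a => if b = a + x then 1 else 0

/-- The phase-basis vector `2^{-n/2} ∑_z (-1)^{x·z} |z⟩`. -/
def phaseKet {n : ℕ} (x : Bits n) : Bits n → ℂ :=
  fun z => ((Real.sqrt (2 ^ n))⁻¹ : ℝ) * sgn (x ⬝ᵥ z)

/-- `|i⟩⟨i|`. -/
def proj {ι : Type*} [DecidableEq ι] (i : ι) : Matrix ι ι ℂ := Matrix.single i i 1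

/-- `|v⟩⟨v|`. -/
def ketBra {ι : Type*} (v : ι → ℂ) : Matrix ι ι ℂ := Matrix.vecMulVec v (star v)

/-- The partial trace over the second tensor factor. -/
def traceRight {ι κ : Type*} [Fintype κ] (M : Matrix (ι × κ) (ι × κ) ℂ) : Matrix ι ι ℂ :=
  Matrix.of fun i j => ∑ k, M (i, k) (j, k)

/-- The `L₁` norm `Tr |M| = Tr √(M† M)`. -/
def traceNorm {ι : Type*} [Fintype ι] [DecidableEq ι] (M : Matrix ι ι ℂ) : ℝ :=
  (CFC.sqrt (Mᴴ * M)).trace.re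

section States

variable {n m : ℕ} {E A' G : Type*} [Fintype E] [DecidableEq E] [Fintype A'] [DecidableEq A']
  [Fintype G] [DecidableEq G]

/-- `ρ^a`, `a ∈ {0,1}^n`, are the blocks of a sub-normalized cq state:
each is positive semi-definite and their traces sum to at most `1`. -/
def IsSubnormalizedCQ (ρ : Bits n → Matrix E E ℂ) : Prop :=
  (∀ a, (ρ a).PosSemidef) ∧ (∑ a, (ρ a).trace).re ≤ 1

/-- The cq state `ρ_AE = ∑_a |a⟩⟨a| ⊗ ρ^a`. -/
def cqState (ρ : Bits n → Matrix E E ℂ) : Matrix (Bits n × E) (Bits n × E) ℂ :=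
  ∑ a, proj a ⊗ₖ ρ a

/-- The vector `Ψ` of `A ⊗ E ⊗ A'` is a purification of `ρ_AE`. -/
def IsPurification (Ψ : (Bits n × E) × A' → ℂ) (ρ : Matrix (Bits n × E) (Bits n × E) ℂ) : Prop :=
  traceRight (ketBra Ψ) = ρ

/-- The real numbers `r` with `2^{-r} 1_A ⊗ σ_E ≥ ρ_AE` for some normalized state `σ_E`. -/
def minEntropySet {A : Type*} [Fintype A] [DecidableEq A]
    (ρ : Matrix (A × E) (A × E) ℂ) : Set ℝ :=
  {r | ∃ σ : Matrix E E ℂ, σ.PosSemidef ∧ σ.trace = 1 ∧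
    ρ ≤ (((2 : ℝ) ^ (-r) : ℝ) : ℂ) • ((1 : Matrix A A ℂ) ⊗ₖ σ)}

/-- The conditional min-entropy `H_min(ρ_AE | E)` of a nonzero sub-normalized state. For such a
state the set is nonempty, bounded above and closed, so that the supremum is its maximum. -/
def condMinEntropy {A : Type*} [Fintype A] [DecidableEq A]
    (ρ : Matrix (A × E) (A × E) ℂ) : ℝ :=
  sSup (minEntropySet ρ)

/-- The key-Eve state `∑_k |k⟩⟨k| ⊗ ∑_{a ∈ g⁻¹(k)} ρ^a` after hashing with `g`. -/
def finalStateKE (ρ : Bits n → Matrix E E ℂ) (g : Bits n → Bits m) :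
    Matrix (Bits m × E) (Bits m × E) ℂ :=
  ∑ k, proj k ⊗ₖ (∑ a with g a = k, ρ a)

/-- The ideal key-Eve state `2^{-m} ∑_k |k⟩⟨k| ⊗ ρ_E`, with `ρ_E = ∑_a ρ^a`. -/
def idealStateKE (m : ℕ) (ρ : Bits n → Matrix E E ℂ) :
    Matrix (Bits m × E) (Bits m × E) ℂ :=
  ((2 : ℂ) ^ m)⁻¹ • ∑ k, proj k ⊗ₖ (∑ a, ρ a)

/-- `∑_g Pr(G = g) τ^g ⊗ |g⟩⟨g|`. -/
def publicMixture {κ : Type*} (p : G → ℝ) (τ : G → Matrix κ κ ℂ) :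
    Matrix (κ × G) (κ × G) ℂ :=
  ∑ g, ((p g : ℝ) : ℂ) • (τ g ⊗ₖ proj g)

/-- The secrecy measure `d₁(ρ_KEG) = ‖ρ_KEG^fin - ρ_KEG^ideal‖₁`. -/
def secrecyDist (p : G → ℝ) (g : G → Bits n → Bits m) (ρ : Bits n → Matrix E E ℂ) : ℝ :=
  traceNorm (publicMixture p (fun i => finalStateKE ρ (g i)) -
    publicMixture p (fun _ => idealStateKE m ρ))

/-- Probability weights on the finite index set of a hash family. -/
def IsProbability (p : G → ℝ) : Prop := (∀ i, 0 ≤ p i) ∧ ∑ i, p i = 1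

/-- The universal₂ property of a random hash function. -/
def IsUniversal2 (p : G → ℝ) (g : G → Bits n → Bits m) : Prop :=
  ∀ a a', a ≠ a' → ∑ i with g i a = g i a', p i ≤ ((2 : ℝ) ^ m)⁻¹

/-- `h` is a check matrix of the classical code `C^g = (ker g)^⊥`. -/
def IsCheckMatrix (g : Bits n →ₗ[ZMod 2] Bits m) (h : Matrix (Fin (n - m)) (Fin n) (ZMod 2)) :
    Prop :=
  ∀ x : Bits n, h *ᵥ x = 0 ↔ ∀ a, g a = 0 → x ⬝ᵥ a = 0

/-- The projection for the outcome `s` of measuring the commuting operators `X^{h_j}`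
(`h_j` the `j`-th row of `h`), i.e. for the eigenvalues `(-1)^{s_j}`. -/
def syndromeProj {r : ℕ} (h : Matrix (Fin r) (Fin n) (ZMod 2)) (s : Bits r) :
    Matrix (Bits n) (Bits n) ℂ :=
  (List.ofFn fun j => (2 : ℂ)⁻¹ • (1 + sgn (s j) • pauliX (h j))).prod

/-- An ancilla measurement for each syndrome `s`: operators `M s e` on `A'` with
`∑_e (M s e)† (M s e) = 1`. -/
def IsAncillaMeasurement {r : ℕ} (M : Bits r → Bits n → Matrix A' A' ℂ) : Prop :=
  ∀ s, ∑ e, (M s e)ᴴ * M s e = 1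

/-- The operator on `A ⊗ E ⊗ A'` for syndrome `s` and estimated error `e`: syndrome projection,
ancilla measurement, phase flip `Z^e`. -/
def pecKraus (E : Type*) [DecidableEq E] {r : ℕ} (h : Matrix (Fin r) (Fin n) (ZMod 2))
    (M : Bits r → Bits n → Matrix A' A' ℂ) (s : Bits r) (e : Bits n) :
    Matrix ((Bits n × E) × A') ((Bits n × E) × A') ℂ :=
  ((pauliZ e * syndromeProj h s) ⊗ₖ (1 : Matrix E E ℂ)) ⊗ₖ M s e

/-- The state after phase error correction of `|Ψ⟩⟨Ψ|`. -/
def pecState {r : ℕ} (h : Matrix (Fin r) (Fin n) (ZMod 2))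
    (M : Bits r → Bits n → Matrix A' A' ℂ) (Ψ : (Bits n × E) × A' → ℂ) :
    Matrix ((Bits n × E) × A') ((Bits n × E) × A') ℂ :=
  ∑ s, ∑ e, pecKraus E h M s e * ketBra Ψ * (pecKraus E h M s e)ᴴ

/-- The phase error probability in `A`: the weight `Tr τ_A - ⟨0~|τ_A|0~⟩` of all phases other
than `0~` in the reduced state `τ_A`. It is `1 - ⟨0~|τ_A|0~⟩` when `τ` is normalized. -/
def phaseErrorProb (τ : Matrix ((Bits n × E) × A') ((Bits n × E) × A') ℂ) : ℝ :=
  ((traceRight (traceRight τ)).trace -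
    star (phaseKet (0 : Bits n)) ⬝ᵥ (traceRight (traceRight τ) *ᵥ phaseKet 0)).re

/-- The average failure probability of phase error correction over the random hash function. -/
def avgFailureProb {r : ℕ} (p : G → ℝ) (h : G → Matrix (Fin r) (Fin n) (ZMod 2))
    (M : G → Bits r → Bits n → Matrix A' A' ℂ) (Ψ : (Bits n × E) × A' → ℂ) : ℝ :=
  ∑ i, p i * phaseErrorProb (pecState (h i) (M i) Ψ)

end States

end PhaseEC

end

/-!
The syndrome operators only shift the bits of `A` within the fibres of the hash function, and the
phase flips are diagonal, so error correction does not change the hashed key. Swapping the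
corrected `A` with a register in the state `|0~⟩` makes the key uniform and independent of `E`, and
the states before and after the swap have purifications `V`, `W` with overlap `Tr ρ - P^ph`. The
first bound is then `‖V V† - W W†‖₁ ≤ 2 √(t² - (Re Tr V W†)²)`, valid for `‖V‖² = ‖W‖² = t`.

For the second bound, put `τ_k = ∑_{g a = k} ρ^a` and choose `S ≥ 0` with `S⁴ = ρ_E`. Any square
roots `X_k X_k† = τ_k` give an ancilla measurement with failure probability at most
`Tr ρ_E - 2^{-m} ‖∑_k X_k‖²`. For `X_k = S √(S⁻¹ τ_k S⁻¹)` this is at most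
`2^m ∑_k Tr (S⁻¹ τ_k S⁻¹)² - Tr ρ_E`, and universality bounds its average over the hash functions
by `2^m ∑_a Tr (S⁻¹ ρ^a S⁻¹)²`, which is at most `2^{m - r}` as soon as `ρ^a ≤ 2^{-r} σ` for all `a`
and some normalized state `σ`.
-/

noncomputable section

namespace PhaseEC

section MatrixAnalysis

variable {ι κ : Type*} [Fintype ι] [Fintype κ]

/-- The real part `Re Tr (X Y†)` of the Hilbert–Schmidt inner product, as a real bilinear form. -/
def hsForm : LinearMap.BilinForm ℝ (Matrix ι κ ℂ) :=
  LinearMap.mk₂ ℝ (fun X Y => (X * Yᴴ).trace.re)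
    (fun X X' Y => by simp [Matrix.add_mul]) (fun c X Y => by simp)
    (fun X Y Y' => by simp [Matrix.mul_add]) (fun c X Y => by simp)

lemma hsForm_apply (X Y : Matrix ι κ ℂ) : hsForm X Y = (X * Yᴴ).trace.re := rfl

lemma hsForm_self_nonneg (X : Matrix ι κ ℂ) : 0 ≤ hsForm X X :=
  (Complex.le_def.1 (Matrix.posSemidef_self_mul_conjTranspose X).trace_nonneg).1

lemma hsForm_comm (X Y : Matrix ι κ ℂ) : hsForm X Y = hsForm Y X := by
  simpa [hsForm_apply] using congrArg Complex.re (Matrix.trace_conjTranspose (Y * Xᴴ))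

lemma hsForm_add_self (X Y : Matrix ι κ ℂ) :
    hsForm (X + Y) (X + Y) = hsForm X X + 2 * hsForm X Y + hsForm Y Y := by
  simp only [map_add, LinearMap.add_apply, hsForm_comm Y X]
  ring

lemma hsForm_sub_self (X Y : Matrix ι κ ℂ) :
    hsForm (X - Y) (X - Y) = hsForm X X - 2 * hsForm X Y + hsForm Y Y := by
  simp only [map_sub, LinearMap.sub_apply, hsForm_comm Y X]
  ring

lemma re_trace_mul_nonneg {A B : Matrix ι ι ℂ} (hA : A.PosSemidef) (hB : B.PosSemidef) :
    0 ≤ (A * B).trace.re := by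
  classical
  obtain ⟨C, rfl⟩ := CStarAlgebra.nonneg_iff_eq_star_mul_self.1 hA.nonneg
  rw [Matrix.mul_assoc, Matrix.trace_mul_comm]
  exact (Complex.le_def.1 (hB.mul_mul_conjTranspose_same C).trace_nonneg).1

lemma re_trace_mul_le_re_trace_mul {A B C : Matrix ι ι ℂ} (hA : A.PosSemidef) (hBC : B ≤ C) :
    (A * B).trace.re ≤ (A * C).trace.re := by
  have := re_trace_mul_nonneg hA (Matrix.le_iff.1 hBC)
  rw [Matrix.mul_sub, Matrix.trace_sub, Complex.sub_re] at this
  linarith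

lemma mul_eq_of_mul_conjTranspose_le {P A : Matrix ι ι ℂ} {X : Matrix ι κ ℂ} (hP : P * A = A)
    (hX : X * Xᴴ ≤ A) : P * X = X := by
  classical
  have h_zero : (1 - P) * (X * Xᴴ) * (1 - P)ᴴ = 0 := by
    have h := (Matrix.le_iff.1 hX).mul_mul_conjTranspose_same (1 - P)
    rw [Matrix.mul_sub, Matrix.sub_mul 1 P A, Matrix.one_mul, hP, sub_self, zero_sub,
      Matrix.neg_mul, ← Matrix.nonneg_iff_posSemidef, neg_nonneg] at h
    exact le_antisymm h (Matrix.nonneg_iff_posSemidef.2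
      ((Matrix.posSemidef_self_mul_conjTranspose X).mul_mul_conjTranspose_same _))
  have : (1 - P) * X = 0 := by
    rw [← Matrix.self_mul_conjTranspose_eq_zero, Matrix.conjTranspose_mul, ← h_zero]
    simp only [Matrix.mul_assoc]
  rw [Matrix.sub_mul, Matrix.one_mul, sub_eq_zero] at this
  exact this.symm

lemma mul_eq_of_posSemidef_of_le {P A B : Matrix ι ι ℂ} (hP : P * A = A) (hB : B.PosSemidef)
    (hBA : B ≤ A) : P * B = B := by
  classical
  obtain ⟨C, rfl⟩ := CStarAlgebra.nonneg_iff_eq_mul_star_self.1 hB.nonneg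
  rw [← Matrix.mul_assoc, mul_eq_of_mul_conjTranspose_le hP hBA]

variable [DecidableEq ι]

/-- For numbers, the difference of the two sides is `v (s - v)² (2 s + v)`. -/
lemma three_re_trace_sq_mul_sq_le {S V : Matrix ι ι ℂ} (hS : S.PosSemidef) (hV : V.PosSemidef) :
    3 * (S ^ 2 * V ^ 2).trace.re ≤ 2 * (S ^ 3 * V).trace.re + (V ^ 4).trace.re := by
  have hSV : (S - V)ᴴ = S - V := by rw [Matrix.conjTranspose_sub, hS.1.eq, hV.1.eq]
  have h_linear : 0 ≤ ((S - V) * S * (S - V) * V).trace.re := by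
    have := hS.mul_mul_conjTranspose_same (S - V)
    rw [hSV] at this
    exact re_trace_mul_nonneg this hV
  have h_square : 0 ≤ ((S - V) * (S - V) * (V * V)).trace.re := by
    have h := hsForm_self_nonneg (V * (S - V))
    rw [hsForm_apply, Matrix.conjTranspose_mul, hSV, hV.1.eq, Matrix.trace_mul_comm,
      ← Matrix.mul_assoc, Matrix.trace_mul_comm] at h
    simpa only [Matrix.mul_assoc] using h
  have h_cycle₁ : (V * (S * (S * V))).trace = (S * (S * (V * V))).trace := by
    rw [Matrix.trace_mul_comm]
    simp only [Matrix.mul_assoc]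
  have h_cycle₂ : (V * (S * (V * V))).trace = (S * (V * (V * V))).trace := by
    rw [Matrix.trace_mul_comm]
    simp only [Matrix.mul_assoc]
  simp only [pow_succ, pow_zero, one_mul, Matrix.mul_assoc, Matrix.sub_mul, Matrix.mul_sub,
    Matrix.trace_sub, Complex.sub_re, h_cycle₁, h_cycle₂] at h_linear h_square ⊢
  linarith

lemma cfc_mul_cfc (A : Matrix ι ι ℂ) (f f' : ℝ → ℝ) :
    cfc f A * cfc f' A = cfc (fun x => f x * f' x) A :=
  (cfc_mul f f' A (A.finite_real_spectrum.continuousOn f)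
    (A.finite_real_spectrum.continuousOn f')).symm

lemma exists_isHermitian_traceNorm_eq {D : Matrix ι ι ℂ} (hD : D.IsHermitian) :
    ∃ S : Matrix ι ι ℂ, S.IsHermitian ∧ S * S = 1 ∧ traceNorm D = (S * D).trace.re := by
  have hD' : IsSelfAdjoint D := hD
  refine ⟨cfc (fun x : ℝ => if 0 ≤ x then 1 else -1) D, cfc_predicate _ D, ?_, ?_⟩
  · rw [cfc_mul_cfc, ← cfc_one ℝ D]
    exact cfc_congr fun x _ => by by_cases hx : 0 ≤ x <;> simp [hx]
  · have h_abs : CFC.abs D = cfc (fun x : ℝ => if 0 ≤ x then 1 else -1) D * D := by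
      nth_rewrite 3 [← cfc_id' ℝ D]
      rw [CFC.abs_eq_cfc_norm D, cfc_mul_cfc]
      refine cfc_congr fun x _ => ?_
      by_cases hx : 0 ≤ x
      · simp [hx, abs_of_nonneg]
      · simp [hx, abs_of_neg (not_le.1 hx)]
    rw [← h_abs]
    rfl

lemma traceNorm_mul_conjTranspose_sub_le {t : ℝ} (V W : Matrix ι κ ℂ) (hV : hsForm V V = t)
    (hW : hsForm W W = t) :
    traceNorm (V * Vᴴ - W * Wᴴ) ≤ 2 * √(t ^ 2 - hsForm V W ^ 2) := by
  obtain ⟨S, hS, hS_sq, hS_norm⟩ : ∃ S : Matrix ι ι ℂ, S.IsHermitian ∧ S * S = 1 ∧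
      traceNorm (V * Vᴴ - W * Wᴴ) = (S * (V * Vᴴ - W * Wᴴ)).trace.re :=
    exists_isHermitian_traceNorm_eq (by simp [Matrix.IsHermitian])
  have h_cross : hsForm (S * V) W = hsForm (S * W) V := by
    rw [hsForm_comm, hsForm_apply, hsForm_apply, Matrix.conjTranspose_mul, hS.eq,
      ← Matrix.mul_assoc, Matrix.trace_mul_comm, Matrix.mul_assoc]
  have h_polar : traceNorm (V * Vᴴ - W * Wᴴ) = hsForm (S * (V - W)) (V + W) := by
    have h_expand : (S * (V * Vᴴ - W * Wᴴ)).trace.re = hsForm (S * V) V - hsForm (S * W) W := by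
      simp [hsForm_apply, Matrix.mul_sub, Matrix.mul_assoc]
    rw [hS_norm, h_expand, Matrix.mul_sub]
    simp only [map_sub, map_add, LinearMap.sub_apply]
    linarith
  have h_isometry : hsForm (S * (V - W)) (S * (V - W)) = hsForm (V - W) (V - W) := by
    rw [hsForm_apply, hsForm_apply, Matrix.conjTranspose_mul, hS.eq, Matrix.mul_assoc,
      Matrix.trace_mul_comm]
    simp only [Matrix.mul_assoc, hS_sq, Matrix.mul_one]
  rw [h_polar]
  calc hsForm (S * (V - W)) (V + W)
      ≤ √(hsForm (S * (V - W)) (S * (V - W)) * hsForm (V + W) (V + W)) :=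
        Real.le_sqrt_of_sq_le (hsForm.apply_sq_le_of_symm hsForm_self_nonneg
          ⟨hsForm_comm⟩ _ _)
    _ = √(2 ^ 2 * (t ^ 2 - hsForm V W ^ 2)) := by
        rw [h_isometry, hsForm_sub_self, hsForm_add_self, hV, hW]
        ring_nf
    _ = 2 * √(t ^ 2 - hsForm V W ^ 2) := by
        rw [Real.sqrt_mul (by positivity), Real.sqrt_sq zero_le_two]

/-- The Moore–Penrose inverse of a Hermitian matrix: its nonzero eigenvalues are inverted, and its
kernel is kept because `0⁻¹ = 0`. -/
def pinv (A : Matrix ι ι ℂ) : Matrix ι ι ℂ := cfc (fun x : ℝ => x⁻¹) A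

lemma isHermitian_pinv (A : Matrix ι ι ℂ) : (pinv A).IsHermitian := cfc_predicate _ A

lemma mul_pinv_comm {A : Matrix ι ι ℂ} (hA : A.IsHermitian) : A * pinv A = pinv A * A := by
  have hA' : IsSelfAdjoint A := hA
  have h := (cfc_commute_cfc id (fun x : ℝ => x⁻¹) A).eq
  rwa [cfc_id ℝ A] at h

lemma mul_pinv_mul_self {A : Matrix ι ι ℂ} (hA : A.IsHermitian) : A * pinv A * A = A := by
  have hA' : IsSelfAdjoint A := hA
  nth_rewrite 1 3 4 [← cfc_id' ℝ A]
  rw [pinv, cfc_mul_cfc, cfc_mul_cfc]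
  exact cfc_congr fun x _ => mul_inv_mul_cancel x

lemma pinv_mul_self_mul_pinv {A : Matrix ι ι ℂ} (hA : A.IsHermitian) :
    pinv A * A * pinv A = pinv A := by
  have hA' : IsSelfAdjoint A := hA
  nth_rewrite 2 [← cfc_id' ℝ A]
  rw [pinv, cfc_mul_cfc, cfc_mul_cfc]
  exact cfc_congr fun x _ => by simpa using mul_inv_mul_cancel x⁻¹

end MatrixAnalysis

section Characters

variable {n m r : ℕ}

lemma sgn_zero : sgn 0 = 1 := by simp [sgn]

lemma sgn_one : sgn 1 = -1 := by simp [sgn, ZMod.val_one]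

lemma bit_eq_zero_or_eq_one (a : ZMod 2) : a = 0 ∨ a = 1 := by
  revert a; decide

lemma sgn_add (a b : ZMod 2) : sgn (a + b) = sgn a * sgn b := by
  rcases bit_eq_zero_or_eq_one a with rfl | rfl <;>
    rcases bit_eq_zero_or_eq_one b with rfl | rfl <;>
    simp [sgn_zero, sgn_one, CharTwo.add_self_eq_zero]

lemma sgn_mul_self (a : ZMod 2) : sgn a * sgn a = 1 := by
  rw [← sgn_add, CharTwo.add_self_eq_zero, sgn_zero]

lemma star_sgn (a : ZMod 2) : star (sgn a) = sgn a := by simp [sgn]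

lemma inv_two_mul_one_add_sgn_mul_sgn (a b : ZMod 2) :
    (2 : ℂ)⁻¹ * (1 + sgn a * sgn b) = if b = a then 1 else 0 := by
  rcases bit_eq_zero_or_eq_one a with rfl | rfl <;>
    rcases bit_eq_zero_or_eq_one b with rfl | rfl <;>
    norm_num [sgn_zero, sgn_one]

lemma sum_sgn_dotProduct (a : Bits n) :
    ∑ x : Bits n, sgn (x ⬝ᵥ a) = if a = 0 then 2 ^ n else 0 := by
  split_ifs with ha
  · simp [ha, sgn_zero, ZMod.card]
  · obtain ⟨j, hj⟩ := Function.ne_iff.1 ha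
    have h_flip : ∀ x : Bits n, sgn ((x + Pi.single j 1) ⬝ᵥ a) = -sgn (x ⬝ᵥ a) := fun x => by
      simp [add_dotProduct, sgn_add, (bit_eq_zero_or_eq_one (a j)).resolve_left hj, sgn_one]
    have h_shift := Equiv.sum_comp (Equiv.addRight (Pi.single j 1 : Bits n)) fun x => sgn (x ⬝ᵥ a)
    simp only [Equiv.coe_addRight, h_flip, Finset.sum_neg_distrib] at h_shift
    linear_combination (-1 / 2 : ℂ) * h_shift

lemma sum_sgn_dotProduct_mul_sgn_dotProduct (a b : Bits n) :
    ∑ x : Bits n, sgn (x ⬝ᵥ a) * sgn (x ⬝ᵥ b) = if a = b then 2 ^ n else 0 := by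
  have : a + b = 0 ↔ a = b := by
    rw [funext_iff, funext_iff]
    exact forall_congr' fun j => CharTwo.add_eq_zero
  simp only [← sgn_add, ← dotProduct_add, sum_sgn_dotProduct, this]

lemma phaseKet_mul_star_phaseKet (x y a b : Bits n) :
    phaseKet x a * star (phaseKet y b) = ((2 : ℂ) ^ n)⁻¹ * (sgn (x ⬝ᵥ a) * sgn (y ⬝ᵥ b)) := by
  have h_sq : ((√(2 ^ n) : ℝ) : ℂ) * (√(2 ^ n) : ℝ) = 2 ^ n := by
    rw [← Complex.ofReal_mul, Real.mul_self_sqrt (by positivity)]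
    simp
  simp only [phaseKet, star_mul', star_sgn, Complex.star_def, Complex.conj_ofReal, ← h_sq, mul_inv]
  rw [Complex.ofReal_inv]
  ring

lemma sum_ketBra_phaseKet : ∑ x : Bits n, ketBra (phaseKet x) = 1 := by
  ext a b
  simp only [Matrix.sum_apply, ketBra, Matrix.vecMulVec_apply, Pi.star_apply,
    phaseKet_mul_star_phaseKet, ← Finset.mul_sum, sum_sgn_dotProduct_mul_sgn_dotProduct,
    Matrix.one_apply]
  split_ifs <;> simp

lemma star_phaseKet_vecMul_pauliZ (x e : Bits n) :
    star (phaseKet x) ᵥ* pauliZ e = star (phaseKet (x + e)) := by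
  funext a
  simp [pauliZ, Matrix.vecMul_diagonal, phaseKet, add_dotProduct, sgn_add, star_sgn, mul_assoc]

lemma pauliX_mulVec (c : Bits n) (v : Bits n → ℂ) : pauliX c *ᵥ v = fun b => v (b + c) := by
  funext b
  have h_shift : ∀ a : Bits n, b = a + c ↔ a = b + c := fun a => by
    rw [← show b - c = b + c from funext fun j => CharTwo.sub_eq_add (b j) (c j),
      eq_sub_iff_add_eq, eq_comm]
  simp [pauliX, Matrix.mulVec, dotProduct, h_shift]

lemma pauliX_mulVec_phaseKet (c x : Bits n) :
    pauliX c *ᵥ phaseKet x = sgn (c ⬝ᵥ x) • phaseKet x := by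
  funext b
  simp only [pauliX_mulVec, Pi.smul_apply, smul_eq_mul, phaseKet, dotProduct_add, sgn_add,
    dotProduct_comm x c]
  ring

lemma syndromeProj_mulVec_phaseKet (h : Matrix (Fin r) (Fin n) (ZMod 2)) (s : Bits r)
    (x : Bits n) :
    syndromeProj h s *ᵥ phaseKet x = (if h *ᵥ x = s then (1 : ℂ) else 0) • phaseKet x := by
  induction r with
  | zero => simp [syndromeProj, Subsingleton.elim (h *ᵥ x) s]
  | succ r ih =>
    have h_cons : syndromeProj h s = ((2 : ℂ)⁻¹ • (1 + sgn (s 0) • pauliX (h.row 0))) *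
        syndromeProj (h.submatrix Fin.succ id) (fun j => s j.succ) := by
      simp only [syndromeProj, List.ofFn_succ, List.prod_cons]
      rfl
    have h_iff : h *ᵥ x = s ↔ h.row 0 ⬝ᵥ x = s 0 ∧
        h.submatrix Fin.succ id *ᵥ x = fun j => s j.succ := by
      simp only [funext_iff, Fin.forall_fin_succ]
      rfl
    have h_factor : ((2 : ℂ)⁻¹ • (1 + sgn (s 0) • pauliX (h.row 0))) *ᵥ phaseKet x
        = (if h.row 0 ⬝ᵥ x = s 0 then (1 : ℂ) else 0) • phaseKet x := by
      rw [Matrix.smul_mulVec, Matrix.add_mulVec, Matrix.smul_mulVec, Matrix.one_mulVec,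
        pauliX_mulVec_phaseKet, ← inv_two_mul_one_add_sgn_mul_sgn]
      module
    rw [h_cons, ← Matrix.mulVec_mulVec, ih, Matrix.mulVec_smul, h_factor, smul_smul]
    by_cases h_head : h.row 0 ⬝ᵥ x = s 0 <;> simp [h_iff, h_head]

lemma syndromeProj_eq_sum_ketBra (h : Matrix (Fin r) (Fin n) (ZMod 2)) (s : Bits r) :
    syndromeProj h s = ∑ x with h *ᵥ x = s, ketBra (phaseKet x) := by
  rw [← Matrix.mul_one (syndromeProj h s), ← sum_ketBra_phaseKet, Matrix.mul_sum,
    Finset.sum_filter]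
  refine Finset.sum_congr rfl fun x _ => ?_
  rw [ketBra, Matrix.mul_vecMulVec, syndromeProj_mulVec_phaseKet]
  split_ifs <;> simp

lemma isHermitian_syndromeProj (h : Matrix (Fin r) (Fin n) (ZMod 2)) (s : Bits r) :
    (syndromeProj h s).IsHermitian := by
  simp [Matrix.IsHermitian, syndromeProj_eq_sum_ketBra, Matrix.conjTranspose_sum, ketBra,
    Matrix.conjTranspose_vecMulVec]

lemma syndromeProj_mul_self (h : Matrix (Fin r) (Fin n) (ZMod 2)) (s : Bits r) :
    syndromeProj h s * syndromeProj h s = syndromeProj h s := by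
  nth_rewrite 2 3 [syndromeProj_eq_sum_ketBra]
  rw [Matrix.mul_sum]
  refine Finset.sum_congr rfl fun x hx => ?_
  rw [ketBra, Matrix.mul_vecMulVec, syndromeProj_mulVec_phaseKet,
    if_pos (Finset.mem_filter.1 hx).2, one_smul]

lemma sum_syndromeProj (h : Matrix (Fin r) (Fin n) (ZMod 2)) : ∑ s, syndromeProj h s = 1 := by
  simp only [syndromeProj_eq_sum_ketBra, Finset.sum_fiberwise, sum_ketBra_phaseKet]

lemma star_phaseKet_vecMul_syndromeProj (h : Matrix (Fin r) (Fin n) (ZMod 2)) (s : Bits r)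
    (e : Bits n) :
    star (phaseKet e) ᵥ* syndromeProj h s
      = (if h *ᵥ e = s then (1 : ℂ) else 0) • star (phaseKet e) := by
  rw [← (isHermitian_syndromeProj h s).eq, ← Matrix.star_mulVec, syndromeProj_mulVec_phaseKet]
  split_ifs <;> simp

end Characters

section CheckMatrix

variable {n m : ℕ} {g : Bits n →ₗ[ZMod 2] Bits m} {h : Matrix (Fin (n - m)) (Fin n) (ZMod 2)}

lemma vecMul_toMatrix'_dotProduct (g : Bits n →ₗ[ZMod 2] Bits m) (u : Bits m) (a : Bits n) :
    (u ᵥ* LinearMap.toMatrix' g) ⬝ᵥ a = u ⬝ᵥ g a := by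
  rw [← Matrix.dotProduct_mulVec, LinearMap.toMatrix'_mulVec]

lemma vecMul_toMatrix'_injective (hg : Function.Surjective g) :
    Function.Injective fun u : Bits m => u ᵥ* LinearMap.toMatrix' g := by
  intro u v huv
  refine dotProduct_eq _ _ fun k => ?_
  obtain ⟨a, rfl⟩ := hg k
  simpa only [vecMul_toMatrix'_dotProduct] using congrArg (· ⬝ᵥ a) huv

lemma IsCheckMatrix.mulVec_eq_zero_iff (hh : IsCheckMatrix g h) (hg : Function.Surjective g)
    (x : Bits n) : h *ᵥ x = 0 ↔ ∃ u : Bits m, u ᵥ* LinearMap.toMatrix' g = x := by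
  rw [hh x]
  constructor
  · intro hx
    obtain ⟨t, ht⟩ := g.exists_rightInverse_of_surjective (LinearMap.range_eq_top.2 hg)
    refine ⟨x ᵥ* LinearMap.toMatrix' t, dotProduct_eq _ _ fun a => ?_⟩
    have h_ker : g (a - t (g a)) = 0 := by
      rw [map_sub, ← LinearMap.comp_apply g t, ht, LinearMap.id_apply, sub_self]
    rw [vecMul_toMatrix'_dotProduct, vecMul_toMatrix'_dotProduct, eq_comm, ← sub_eq_zero,
      ← dotProduct_sub, hx _ h_ker]
  · rintro ⟨u, rfl⟩ a ha
    rw [vecMul_toMatrix'_dotProduct, ha, dotProduct_zero]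

lemma IsCheckMatrix.sum_coset {M : Type*} [AddCommMonoid M] (hh : IsCheckMatrix g h)
    (hg : Function.Surjective g) (z : Bits n) (F : Bits n → M) :
    ∑ x with h *ᵥ x = h *ᵥ z, F x = ∑ u, F (z + u ᵥ* LinearMap.toMatrix' g) := by
  symm
  refine Finset.sum_nbij (fun u => z + u ᵥ* LinearMap.toMatrix' g) (fun u _ => ?_)
    (fun u _ v _ huv => vecMul_toMatrix'_injective hg (add_left_cancel huv)) (fun x hx => ?_)
    fun _ _ => rfl
  · simp [Matrix.mulVec_add, (hh.mulVec_eq_zero_iff hg _).2 ⟨u, rfl⟩]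
  · have h_sub : h *ᵥ (x - z) = 0 := by
      rw [Matrix.mulVec_sub, (Finset.mem_filter.1 hx).2, sub_self]
    obtain ⟨u, hu⟩ := (hh.mulVec_eq_zero_iff hg _).1 h_sub
    exact ⟨u, by simp, by simp [hu]⟩

lemma IsCheckMatrix.sum_coset_sgn_mul_sgn (hh : IsCheckMatrix g h) (hg : Function.Surjective g)
    (z a b : Bits n) :
    ∑ x with h *ᵥ x = h *ᵥ z, sgn (x ⬝ᵥ a) * sgn (x ⬝ᵥ b)
      = if g a = g b then 2 ^ m * (sgn (z ⬝ᵥ a) * sgn (z ⬝ᵥ b)) else 0 := by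
  have h_split : ∀ u : Bits m, sgn ((z + u ᵥ* LinearMap.toMatrix' g) ⬝ᵥ a) *
      sgn ((z + u ᵥ* LinearMap.toMatrix' g) ⬝ᵥ b)
      = (sgn (z ⬝ᵥ a) * sgn (z ⬝ᵥ b)) * (sgn (u ⬝ᵥ g a) * sgn (u ⬝ᵥ g b)) := fun u => by
    simp only [add_dotProduct, sgn_add, vecMul_toMatrix'_dotProduct]
    ring
  simp only [hh.sum_coset hg, h_split, ← Finset.mul_sum, sum_sgn_dotProduct_mul_sgn_dotProduct,
    mul_ite, mul_zero]
  simp only [mul_comm]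

lemma IsCheckMatrix.syndromeProj_apply_eq_zero (hh : IsCheckMatrix g h)
    (hg : Function.Surjective g) (s : Bits (n - m)) {a b : Bits n} (hab : g a ≠ g b) :
    syndromeProj h s a b = 0 := by
  simp only [syndromeProj_eq_sum_ketBra, Matrix.sum_apply, ketBra, Matrix.vecMulVec_apply,
    Pi.star_apply, phaseKet_mul_star_phaseKet, ← Finset.mul_sum]
  by_cases hs : ∃ z, h *ᵥ z = s
  · obtain ⟨z, rfl⟩ := hs
    rw [hh.sum_coset_sgn_mul_sgn hg, if_neg hab, mul_zero]
  · simp [not_exists.1 hs]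

lemma two_pow_mul_card_fiber (hg : Function.Surjective g) (k : Bits m) :
    2 ^ m * (Finset.univ.filter fun a => g a = k).card = 2 ^ n := by
  have h_const : ∀ l, (Finset.univ.filter fun a => g a = l).card
      = (Finset.univ.filter fun a => g a = k).card := fun l =>
    AddMonoidHom.card_fiber_eq_of_mem_range g (hg l) (hg k)
  have h_sum := Finset.card_eq_sum_card_fiberwise (s := (Finset.univ : Finset (Bits n)))
    (t := Finset.univ) (f := g) (by simp)
  simpa [h_const, ZMod.card] using h_sum.symm

end CheckMatrix

section Blocks

variable {ι A E A' : Type*}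

/-- The component `⟨a|_A Ψ` of a vector of `A ⊗ E ⊗ A'`, encoded as a matrix from `A'` to `E`. -/
def block (Ψ : (A × E) × A' → ℂ) (a : A) : Matrix E A' ℂ :=
  Matrix.of fun ε α => Ψ ((a, ε), α)

/-- The component `∑_a v_a ⟨a|_A` of a vector with blocks `y a = ⟨a|_A`. There is no complex
conjugation: the bra `⟨w|` corresponds to `v = star w`. -/
def contract [Fintype ι] (v : ι → ℂ) (y : ι → Matrix E A' ℂ) : Matrix E A' ℂ :=
  ∑ a, v a • y a

lemma contract_smul [Fintype ι] (c : ℂ) (v : ι → ℂ) (y : ι → Matrix E A' ℂ) :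
    contract (c • v) y = c • contract v y := by
  simp only [contract, Pi.smul_apply, smul_assoc, Finset.smul_sum]

lemma contract_mul_conjTranspose [Fintype ι] [Fintype A'] (u v : ι → ℂ)
    (y : ι → Matrix E A' ℂ) :
    contract u y * (contract v y)ᴴ = ∑ a, ∑ b, (u a * star (v b)) • (y a * (y b)ᴴ) := by
  simp only [contract, Matrix.conjTranspose_sum, Matrix.conjTranspose_smul, Matrix.sum_mul,
    Matrix.mul_sum, Matrix.smul_mul, Matrix.mul_smul, Finset.smul_sum]
  rw [Finset.sum_comm]
  simp only [smul_smul, mul_comm]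

lemma contract_mul_conjTranspose_of_orthogonal [Fintype ι] [DecidableEq ι] [Fintype A']
    {y : ι → Matrix E A' ℂ} {ρ : ι → Matrix E E ℂ}
    (hy : ∀ a b, y a * (y b)ᴴ = if a = b then ρ a else 0) (u v : ι → ℂ) :
    contract u y * (contract v y)ᴴ = ∑ a, (u a * star (v a)) • ρ a := by
  simp [contract_mul_conjTranspose, hy]

variable [Fintype A] [Fintype E] [DecidableEq E] [Fintype A']

lemma block_kronecker_mulVec (K : Matrix A A ℂ) (M : Matrix A' A' ℂ) (Ψ : (A × E) × A' → ℂ)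
    (a : A) :
    block (((K ⊗ₖ (1 : Matrix E E ℂ)) ⊗ₖ M) *ᵥ Ψ) a = contract (K a) (block Ψ) * Mᵀ := by
  ext ε α
  simp only [block, contract, Matrix.of_apply, Matrix.mulVec, dotProduct, Fintype.sum_prod_type,
    Matrix.kroneckerMap_apply, Matrix.one_apply, Matrix.mul_apply, Matrix.sum_apply,
    Matrix.smul_apply, smul_eq_mul, Matrix.transpose_apply, Finset.sum_mul, mul_ite, mul_one,
    mul_zero, ite_mul, zero_mul]
  rw [Finset.sum_comm (s := (Finset.univ : Finset A'))]
  refine Finset.sum_congr rfl fun b _ => ?_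
  rw [Finset.sum_comm]
  refine Finset.sum_congr rfl fun β _ => ?_
  rw [Finset.sum_ite_eq, if_pos (Finset.mem_univ ε)]
  ring

lemma contract_block_kronecker_mulVec (u : A → ℂ) (K : Matrix A A ℂ) (M : Matrix A' A' ℂ)
    (Ψ : (A × E) × A' → ℂ) :
    contract u (block (((K ⊗ₖ (1 : Matrix E E ℂ)) ⊗ₖ M) *ᵥ Ψ))
      = contract (u ᵥ* K) (block Ψ) * Mᵀ := by
  have h_assoc : contract (u ᵥ* K) (block Ψ) = ∑ a, u a • contract (K a) (block Ψ) := by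
    simp only [contract, Matrix.vecMul, dotProduct, Finset.sum_smul, Finset.smul_sum, smul_smul]
    exact Finset.sum_comm
  rw [h_assoc, contract, Matrix.sum_mul]
  simp only [block_kronecker_mulVec, Matrix.smul_mul]

end Blocks

section Purifications

variable {n : ℕ} {E A' J : Type*}

lemma traceRight_sum {ι κ σ : Type*} [Fintype κ] (t : Finset σ)
    (f : σ → Matrix (ι × κ) (ι × κ) ℂ) :
    traceRight (∑ i ∈ t, f i) = ∑ i ∈ t, traceRight (f i) := by
  ext i j
  simp only [traceRight, Matrix.of_apply, Matrix.sum_apply]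
  exact Finset.sum_comm

lemma cqState_apply (ρ : Bits n → Matrix E E ℂ) (a b : Bits n) (ε ε' : E) :
    cqState ρ (a, ε) (b, ε') = if a = b then ρ a ε ε' else 0 := by
  simp [cqState, Matrix.sum_apply, proj, Matrix.single_apply, ite_and]

lemma IsPurification.block_mul_conjTranspose [Fintype A'] {ρ : Bits n → Matrix E E ℂ}
    {Ψ : (Bits n × E) × A' → ℂ} (hΨ : IsPurification Ψ (cqState ρ)) (a b : Bits n) :
    block Ψ a * (block Ψ b)ᴴ = if a = b then ρ a else 0 := by
  ext ε ε'
  have h_entry := congrFun (congrFun hΨ (a, ε)) (b, ε')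
  rw [cqState_apply] at h_entry
  calc (block Ψ a * (block Ψ b)ᴴ) ε ε' = traceRight (ketBra Ψ) (a, ε) (b, ε') := by
        simp [block, Matrix.mul_apply, traceRight, ketBra, Matrix.vecMulVec_apply]
    _ = _ := by rw [h_entry]; split_ifs <;> rfl

lemma IsPurification.posSemidef [Finite E] [Fintype A'] {ρ : Bits n → Matrix E E ℂ}
    {Ψ : (Bits n × E) × A' → ℂ} (hΨ : IsPurification Ψ (cqState ρ)) (a : Bits n) :
    (ρ a).PosSemidef := by
  simpa only [hΨ.block_mul_conjTranspose, if_true] using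
    Matrix.posSemidef_self_mul_conjTranspose (block Ψ a)

variable [Fintype A'] [Fintype J]

/-- The block `⟨a|_A τ_AE |a⟩_A` of the reduced state of the mixture `∑_j |Φ_j⟩⟨Φ_j|`. -/
def diagBlock (Φ : J → (Bits n × E) × A' → ℂ) (a : Bits n) : Matrix E E ℂ :=
  ∑ j, block (Φ j) a * (block (Φ j) a)ᴴ

variable [Fintype E]

lemma traceRight_traceRight_ketBra (Ψ : (Bits n × E) × A' → ℂ) (a b : Bits n) :
    traceRight (traceRight (ketBra Ψ)) a b = (block Ψ a * (block Ψ b)ᴴ).trace := by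
  simp [traceRight, ketBra, block, Matrix.vecMulVec_apply, Matrix.trace, Matrix.mul_apply]

lemma star_dotProduct_traceRight_traceRight_mulVec (v : Bits n → ℂ)
    (Ψ : (Bits n × E) × A' → ℂ) :
    star v ⬝ᵥ (traceRight (traceRight (ketBra Ψ)) *ᵥ v)
      = (contract (star v) (block Ψ) * (contract (star v) (block Ψ))ᴴ).trace := by
  simp only [contract_mul_conjTranspose, Matrix.trace_sum, Matrix.trace_smul, dotProduct,
    Matrix.mulVec, traceRight_traceRight_ketBra, Finset.mul_sum, Pi.star_apply, star_star,
    smul_eq_mul]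
  exact Finset.sum_congr rfl fun a _ => Finset.sum_congr rfl fun b _ => by ring

lemma phaseErrorProb_sum_ketBra (Φ : J → (Bits n × E) × A' → ℂ) :
    phaseErrorProb (∑ j, ketBra (Φ j)) = (∑ a, diagBlock Φ a).trace.re
      - ∑ j, hsForm (contract (star (phaseKet 0)) (block (Φ j)))
          (contract (star (phaseKet 0)) (block (Φ j))) := by
  have h_trace : (traceRight (traceRight (∑ j, ketBra (Φ j)))).trace
      = (∑ a, diagBlock Φ a).trace := by
    simp only [traceRight_sum, diagBlock, Matrix.trace_sum]
    rw [Finset.sum_comm]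
    simp only [Matrix.trace, Matrix.diag_apply, traceRight_traceRight_ketBra]
  rw [phaseErrorProb, h_trace, Complex.sub_re]
  simp only [traceRight_sum, Matrix.sum_mulVec, dotProduct_sum,
    star_dotProduct_traceRight_traceRight_mulVec, Complex.re_sum, hsForm_apply]

end Purifications

section LabelledPurifications

variable {E A' K L : Type*} [Fintype A'] [Fintype L] [DecidableEq K]

/-- The matrix from `L ⊗ A'` to `K ⊗ E` with blocks `|k l⟩⟨l| ⊗ y l`: a purification of a
classical-quantum state on `K ⊗ E` in which the purifying party keeps the label `l`. -/
def labelledPurif (k : L → K) (y : L → Matrix E A' ℂ) : Matrix (K × E) (L × A') ℂ :=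
  Matrix.of fun i j => if k j.1 = i.1 then y j.1 i.2 j.2 else 0

lemma labelledPurif_mul_conjTranspose (k : L → K) (y z : L → Matrix E A' ℂ) :
    labelledPurif k y * (labelledPurif k z)ᴴ = ∑ l, proj (k l) ⊗ₖ (y l * (z l)ᴴ) := by
  ext ⟨i, ε⟩ ⟨i', ε'⟩
  simp only [labelledPurif, Matrix.mul_apply, Matrix.of_apply, Matrix.conjTranspose_apply,
    Fintype.sum_prod_type, Matrix.sum_apply, Matrix.kroneckerMap_apply, proj, Matrix.single_apply]
  refine Finset.sum_congr rfl fun l _ => ?_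
  rcases eq_or_ne (k l) i with rfl | hi
  · rcases eq_or_ne (k l) i' with rfl | hi'
    · simp
    · simp [hi']
  · simp [hi]

end LabelledPurifications

section KeyStates

variable {n m : ℕ} {E A' J : Type*}

lemma kronecker_sum {K ι : Type*} (P : Matrix K K ℂ) (s : Finset ι) (X : ι → Matrix E E ℂ) :
    P ⊗ₖ (∑ i ∈ s, X i) = ∑ i ∈ s, P ⊗ₖ X i :=
  map_sum (Matrix.kroneckerBilinear (R := ℂ) P) X s

lemma finalStateKE_eq_sum_proj (τ : Bits n → Matrix E E ℂ) (g : Bits n → Bits m) :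
    finalStateKE τ g = ∑ a, proj (g a) ⊗ₖ τ a := by
  rw [finalStateKE, ← Finset.sum_fiberwise Finset.univ g]
  refine Finset.sum_congr rfl fun k _ => ?_
  rw [kronecker_sum]
  exact Finset.sum_congr rfl fun a ha => by rw [(Finset.mem_filter.1 ha).2]

lemma inv_two_pow_smul_sum_proj {g : Bits n →ₗ[ZMod 2] Bits m} (hg : Function.Surjective g)
    (X : Matrix E E ℂ) :
    ((2 : ℂ) ^ n)⁻¹ • ∑ a, proj (g a) ⊗ₖ X = ((2 : ℂ) ^ m)⁻¹ • ∑ k : Bits m, proj k ⊗ₖ X := by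
  rw [← Finset.sum_fiberwise Finset.univ g, Finset.smul_sum, Finset.smul_sum]
  refine Finset.sum_congr rfl fun k _ => ?_
  have h_fiber : ∑ a with g a = k, proj (g a) ⊗ₖ X
      = (Finset.univ.filter fun a => g a = k).card • (proj k ⊗ₖ X) := by
    rw [← Finset.sum_const]
    exact Finset.sum_congr rfl fun a ha => by rw [(Finset.mem_filter.1 ha).2]
  have h_card : (2 : ℂ) ^ m * (Finset.univ.filter fun a => g a = k).card = 2 ^ n := by
    exact_mod_cast two_pow_mul_card_fiber hg k
  rw [h_fiber, ← Nat.cast_smul_eq_nsmul ℂ, smul_smul]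
  congr 1
  rw [inv_mul_eq_iff_eq_mul₀ (by positivity), ← h_card]
  field_simp

lemma trace_finalStateKE [Fintype E] (ρ : Bits n → Matrix E E ℂ) (g : Bits n → Bits m) :
    (finalStateKE ρ g).trace = (∑ a, ρ a).trace := by
  simp [finalStateKE_eq_sum_proj, Matrix.trace_sum, Matrix.trace_kronecker, proj]

lemma trace_idealStateKE [Fintype E] (ρ : Bits n → Matrix E E ℂ) :
    (idealStateKE m ρ).trace = (∑ a, ρ a).trace := by
  simp [idealStateKE, Matrix.trace_sum, Matrix.trace_kronecker, proj, ZMod.card]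

lemma phaseKet_zero_mul_star_phaseKet_zero (a b : Bits n) :
    phaseKet 0 a * star (phaseKet 0 b) = ((2 : ℂ) ^ n)⁻¹ := by
  simp only [phaseKet_mul_star_phaseKet, zero_dotProduct, sgn_zero, mul_one]

/-- The original state and the swapped one overlap in `⟨0~|_A τ_A |0~⟩` when `A` is swapped with an
additional register in the state `|0~⟩`; the key hashed from the latter register is uniform. -/
lemma exists_purifications_finalStateKE_idealStateKE [Fintype E] [Fintype A'] [Fintype J]
    {g : Bits n →ₗ[ZMod 2] Bits m} (hg : Function.Surjective g)
    (Φ : J → (Bits n × E) × A' → ℂ) :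
    ∃ V W : Matrix (Bits m × E) ((J × Bits n × Bits n) × A') ℂ,
      V * Vᴴ = finalStateKE (diagBlock Φ) g ∧ W * Wᴴ = idealStateKE m (diagBlock Φ) ∧
      hsForm V W = (∑ a, diagBlock Φ a).trace.re - phaseErrorProb (∑ j, ketBra (Φ j)) := by
  refine ⟨labelledPurif (fun l => g l.2.1) fun l => phaseKet 0 l.2.2 • block (Φ l.1) l.2.1,
    labelledPurif (fun l => g l.2.1) fun l => phaseKet 0 l.2.1 • block (Φ l.1) l.2.2,
    ?_, ?_, ?_⟩
  · rw [finalStateKE_eq_sum_proj, labelledPurif_mul_conjTranspose]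
    simp only [Matrix.conjTranspose_smul, Matrix.smul_mul, Matrix.mul_smul, smul_smul,
      mul_comm (star _), phaseKet_zero_mul_star_phaseKet_zero, Fintype.sum_prod_type,
      Finset.sum_const, diagBlock, kronecker_sum]
    rw [Finset.sum_comm]
    simp [← Nat.cast_smul_eq_nsmul ℂ, Matrix.kronecker_smul, smul_smul, ZMod.card]
  · rw [idealStateKE, ← inv_two_pow_smul_sum_proj hg, labelledPurif_mul_conjTranspose]
    simp only [Matrix.conjTranspose_smul, Matrix.smul_mul, Matrix.mul_smul, smul_smul,
      mul_comm (star _), phaseKet_zero_mul_star_phaseKet_zero, Fintype.sum_prod_type,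
      diagBlock, kronecker_sum, Matrix.kronecker_smul, ← Finset.smul_sum]
    rw [Finset.sum_comm]
    exact congrArg _ (Finset.sum_congr rfl fun a _ => Finset.sum_comm)
  · rw [phaseErrorProb_sum_ketBra, sub_sub_cancel]
    simp only [hsForm_apply, labelledPurif_mul_conjTranspose, Fintype.sum_prod_type,
      contract_mul_conjTranspose, Matrix.trace_sum, Matrix.trace_kronecker, Matrix.trace_smul,
      Complex.re_sum, proj, Matrix.trace_single_eq_same, one_mul, Matrix.conjTranspose_smul,
      Matrix.smul_mul, Matrix.mul_smul, smul_smul, Pi.star_apply, star_star, mul_comm (star _)]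

end KeyStates

section PhaseErrorCorrection

variable {n m r : ℕ} {E A' : Type*} [Fintype E] [DecidableEq E] [Fintype A']

/-- The unnormalized pure states after phase error correction, indexed by the syndrome and the
estimated error. -/
def pecVec (h : Matrix (Fin r) (Fin n) (ZMod 2)) (M : Bits r → Bits n → Matrix A' A' ℂ)
    (Ψ : (Bits n × E) × A' → ℂ) (j : Bits r × Bits n) : (Bits n × E) × A' → ℂ :=
  pecKraus E h M j.1 j.2 *ᵥ Ψ

lemma pecState_eq_sum_ketBra (h : Matrix (Fin r) (Fin n) (ZMod 2))
    (M : Bits r → Bits n → Matrix A' A' ℂ) (Ψ : (Bits n × E) × A' → ℂ) :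
    pecState h M Ψ = ∑ j, ketBra (pecVec h M Ψ j) := by
  simp only [pecState, pecVec, ketBra, Fintype.sum_prod_type, Matrix.mul_vecMulVec,
    Matrix.vecMulVec_mul, Matrix.star_mulVec]

lemma block_pecVec (h : Matrix (Fin r) (Fin n) (ZMod 2)) (M : Bits r → Bits n → Matrix A' A' ℂ)
    (Ψ : (Bits n × E) × A' → ℂ) (s : Bits r) (e a : Bits n) :
    block (pecVec h M Ψ (s, e)) a
      = sgn (e ⬝ᵥ a) • (contract (syndromeProj h s a) (block Ψ) * (M s e)ᵀ) := by
  have h_row : (pauliZ e * syndromeProj h s) a = sgn (e ⬝ᵥ a) • syndromeProj h s a := by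
    funext b
    simp [pauliZ, Matrix.diagonal_mul]
  rw [pecVec, pecKraus, block_kronecker_mulVec, h_row, contract_smul, Matrix.smul_mul]

lemma contract_phaseKet_zero_block_pecVec (h : Matrix (Fin r) (Fin n) (ZMod 2))
    (M : Bits r → Bits n → Matrix A' A' ℂ) (Ψ : (Bits n × E) × A' → ℂ) (s : Bits r)
    (e : Bits n) :
    contract (star (phaseKet 0)) (block (pecVec h M Ψ (s, e)))
      = if h *ᵥ e = s then contract (star (phaseKet e)) (block Ψ) * (M s e)ᵀ else 0 := by
  rw [pecVec, pecKraus, contract_block_kronecker_mulVec, ← Matrix.vecMul_vecMul,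
    star_phaseKet_vecMul_pauliZ, zero_add, star_phaseKet_vecMul_syndromeProj]
  split_ifs <;> simp [contract]

lemma sum_hsForm_contract_phaseKet_zero_pecVec (h : Matrix (Fin r) (Fin n) (ZMod 2))
    (M : Bits r → Bits n → Matrix A' A' ℂ) (Ψ : (Bits n × E) × A' → ℂ) :
    ∑ j, hsForm (contract (star (phaseKet 0)) (block (pecVec h M Ψ j)))
        (contract (star (phaseKet 0)) (block (pecVec h M Ψ j)))
      = ∑ e, hsForm (contract (star (phaseKet e)) (block Ψ) * (M (h *ᵥ e) e)ᵀ)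
          (contract (star (phaseKet e)) (block Ψ) * (M (h *ᵥ e) e)ᵀ) := by
  rw [Fintype.sum_prod_type_right]
  refine Finset.sum_congr rfl fun e _ => ?_
  rw [Finset.sum_eq_single (h *ᵥ e) (fun s _ hs => ?_) (by simp)]
  · rw [contract_phaseKet_zero_block_pecVec, if_pos rfl]
  · rw [contract_phaseKet_zero_block_pecVec, if_neg hs.symm, map_zero]

variable [DecidableEq A'] {ρ : Bits n → Matrix E E ℂ} {Ψ : (Bits n × E) × A' → ℂ}

lemma IsPurification.diagBlock_pecVec (hΨ : IsPurification Ψ (cqState ρ))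
    (h : Matrix (Fin r) (Fin n) (ZMod 2)) {M : Bits r → Bits n → Matrix A' A' ℂ}
    (hM : IsAncillaMeasurement M) (a : Bits n) :
    diagBlock (pecVec h M Ψ) a
      = ∑ s, ∑ b, (syndromeProj h s a b * star (syndromeProj h s a b)) • ρ b := by
  rw [diagBlock, Fintype.sum_prod_type]
  refine Finset.sum_congr rfl fun s _ => ?_
  rw [← contract_mul_conjTranspose_of_orthogonal hΨ.block_mul_conjTranspose]
  set X := contract (syndromeProj h s a) (block Ψ)
  have h_outcome : ∀ e, block (pecVec h M Ψ (s, e)) a * (block (pecVec h M Ψ (s, e)) a)ᴴ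
      = X * ((M s e)ᴴ * M s e)ᵀ * Xᴴ := fun e => by
    rw [block_pecVec, Matrix.conjTranspose_smul, Matrix.smul_mul, Matrix.mul_smul, smul_smul,
      star_sgn, sgn_mul_self, one_smul, Matrix.conjTranspose_mul, Matrix.transpose_mul]
    simp only [X, Matrix.mul_assoc]
    rfl
  simp only [h_outcome, ← Matrix.mul_sum, ← Matrix.sum_mul, ← Matrix.transpose_sum, hM s,
    Matrix.transpose_one, Matrix.mul_one]

variable {g : Bits n →ₗ[ZMod 2] Bits m} {h : Matrix (Fin (n - m)) (Fin n) (ZMod 2)}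

lemma IsCheckMatrix.sum_syndromeProj_mul_star_fiber (hh : IsCheckMatrix g h)
    (hg : Function.Surjective g) (k : Bits m) (b : Bits n) :
    ∑ a with g a = k, ∑ s, syndromeProj h s a b * star (syndromeProj h s a b)
      = if g b = k then 1 else 0 := by
  have h_zero : ∀ s a, g a ≠ g b → syndromeProj h s a b * star (syndromeProj h s a b) = 0 :=
    fun s a hab => by rw [hh.syndromeProj_apply_eq_zero hg s hab, zero_mul]
  have h_column : ∀ s, ∑ a, syndromeProj h s a b * star (syndromeProj h s a b)
      = syndromeProj h s b b := fun s => by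
    nth_rewrite 3 [← syndromeProj_mul_self]
    rw [Matrix.mul_apply]
    refine Finset.sum_congr rfl fun a _ => ?_
    rw [mul_comm, ← Matrix.conjTranspose_apply, (isHermitian_syndromeProj h s).eq]
  split_ifs with hb
  · subst hb
    have h_all : ∑ a with g a = g b, ∑ s, syndromeProj h s a b * star (syndromeProj h s a b)
        = ∑ a, ∑ s, syndromeProj h s a b * star (syndromeProj h s a b) :=
      Finset.sum_filter_of_ne fun a _ ha => by
        contrapose! ha
        exact Finset.sum_eq_zero fun s _ => h_zero s a ha
    rw [h_all, Finset.sum_comm]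
    simp only [h_column]
    rw [← Matrix.sum_apply, sum_syndromeProj, Matrix.one_apply_eq]
  · refine Finset.sum_eq_zero fun a ha => Finset.sum_eq_zero fun s _ => h_zero s a ?_
    rw [(Finset.mem_filter.1 ha).2]
    exact Ne.symm hb

lemma IsPurification.sum_diagBlock_pecVec_fiber (hΨ : IsPurification Ψ (cqState ρ))
    (hg : Function.Surjective g) (hh : IsCheckMatrix g h)
    {M : Bits (n - m) → Bits n → Matrix A' A' ℂ} (hM : IsAncillaMeasurement M) (k : Bits m) :
    ∑ a with g a = k, diagBlock (pecVec h M Ψ) a = ∑ a with g a = k, ρ a := by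
  calc ∑ a with g a = k, diagBlock (pecVec h M Ψ) a
      = ∑ b, (∑ a with g a = k, ∑ s,
          syndromeProj h s a b * star (syndromeProj h s a b)) • ρ b := by
        simp only [hΨ.diagBlock_pecVec h hM, Finset.sum_smul]
        rw [Finset.sum_comm (s := (Finset.univ : Finset (Bits n)))]
        exact Finset.sum_congr rfl fun a _ => Finset.sum_comm
    _ = ∑ a with g a = k, ρ a := by
        simp only [hh.sum_syndromeProj_mul_star_fiber hg, ite_smul, one_smul, zero_smul,
          Finset.sum_filter]

lemma IsPurification.sum_diagBlock_pecVec (hΨ : IsPurification Ψ (cqState ρ))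
    (hg : Function.Surjective g) (hh : IsCheckMatrix g h)
    {M : Bits (n - m) → Bits n → Matrix A' A' ℂ} (hM : IsAncillaMeasurement M) :
    ∑ a, diagBlock (pecVec h M Ψ) a = ∑ a, ρ a := by
  rw [← Finset.sum_fiberwise Finset.univ g, ← Finset.sum_fiberwise Finset.univ g ρ]
  exact Finset.sum_congr rfl fun k _ => hΨ.sum_diagBlock_pecVec_fiber hg hh hM k

lemma IsPurification.phaseErrorProb_pecState (hΨ : IsPurification Ψ (cqState ρ))
    (hg : Function.Surjective g) (hh : IsCheckMatrix g h)
    {M : Bits (n - m) → Bits n → Matrix A' A' ℂ} (hM : IsAncillaMeasurement M) :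
    phaseErrorProb (pecState h M Ψ) = (∑ a, ρ a).trace.re
      - ∑ e, hsForm (contract (star (phaseKet e)) (block Ψ) * (M (h *ᵥ e) e)ᵀ)
          (contract (star (phaseKet e)) (block Ψ) * (M (h *ᵥ e) e)ᵀ) := by
  rw [pecState_eq_sum_ketBra, phaseErrorProb_sum_ketBra, hΨ.sum_diagBlock_pecVec hg hh hM,
    sum_hsForm_contract_phaseKet_zero_pecVec]

lemma IsPurification.exists_purifications_pecState (hΨ : IsPurification Ψ (cqState ρ))
    (hg : Function.Surjective g) (hh : IsCheckMatrix g h)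
    {M : Bits (n - m) → Bits n → Matrix A' A' ℂ} (hM : IsAncillaMeasurement M) :
    ∃ V W : Matrix (Bits m × E)
        (((Bits (n - m) × Bits n) × Bits n × Bits n) × A') ℂ,
      V * Vᴴ = finalStateKE ρ g ∧ W * Wᴴ = idealStateKE m ρ ∧
      hsForm V W = (∑ a, ρ a).trace.re - phaseErrorProb (pecState h M Ψ) := by
  obtain ⟨V, W, hV, hW, hVW⟩ :=
    exists_purifications_finalStateKE_idealStateKE hg (pecVec h M Ψ)
  refine ⟨V, W, ?_, ?_, ?_⟩
  · simp only [hV, finalStateKE, hΨ.sum_diagBlock_pecVec_fiber hg hh hM]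
  · simp only [hW, idealStateKE, hΨ.sum_diagBlock_pecVec hg hh hM]
  · rw [hVW, hΨ.sum_diagBlock_pecVec hg hh hM, pecState_eq_sum_ketBra]

end PhaseErrorCorrection

section SecrecyBound

variable {n m : ℕ} {E A' G : Type*} [Fintype E] [DecidableEq E] [Fintype G] [DecidableEq G]

/-- The direct sum of the matrices `√p_i V_i`: a purification of `publicMixture` for purifications
`V_i` of its components. -/
def mixturePurif {κ γ : Type*} (p : G → ℝ) (V : G → Matrix κ γ ℂ) :
    Matrix (κ × G) (γ × G) ℂ :=
  ∑ i, ((√(p i) : ℝ) : ℂ) • (V i ⊗ₖ proj i)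

lemma mixturePurif_mul_conjTranspose {κ γ : Type*} [Fintype γ] {p : G → ℝ} (hp : ∀ i, 0 ≤ p i)
    (V W : G → Matrix κ γ ℂ) :
    mixturePurif p V * (mixturePurif p W)ᴴ = publicMixture p fun i => V i * (W i)ᴴ := by
  simp only [mixturePurif, publicMixture, Matrix.conjTranspose_sum, Matrix.conjTranspose_smul,
    Matrix.sum_mul, Matrix.mul_sum, Matrix.smul_mul, Matrix.mul_smul,
    Matrix.conjTranspose_kronecker, ← Matrix.mul_kronecker_mul, Complex.star_def,
    Complex.conj_ofReal]
  refine Finset.sum_congr rfl fun i _ => ?_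
  rw [Finset.sum_eq_single i (fun j _ hj => ?_) (by simp)]
  · rw [smul_smul, ← Complex.ofReal_mul, Real.mul_self_sqrt (hp i)]
    simp [proj]
  · simp [proj, hj]

lemma re_trace_publicMixture {κ : Type*} [Fintype κ] (p : G → ℝ) (τ : G → Matrix κ κ ℂ) :
    (publicMixture p τ).trace.re = ∑ i, p i * (τ i).trace.re := by
  simp [publicMixture, Matrix.trace_sum, Matrix.trace_kronecker, proj]

variable [Fintype A'] [DecidableEq A'] {ρ : Bits n → Matrix E E ℂ}
  {Ψ : (Bits n × E) × A' → ℂ} {p : G → ℝ} {g : G → Bits n →ₗ[ZMod 2] Bits m}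
  {h : G → Matrix (Fin (n - m)) (Fin n) (ZMod 2)}
  {M : G → Bits (n - m) → Bits n → Matrix A' A' ℂ}

lemma IsPurification.secrecyDist_le_two_mul_sqrt (hΨ : IsPurification Ψ (cqState ρ))
    (hp : IsProbability p) (hg : ∀ i, Function.Surjective (g i))
    (hh : ∀ i, IsCheckMatrix (g i) (h i)) (hM : ∀ i, IsAncillaMeasurement (M i)) :
    secrecyDist p (fun i => ⇑(g i)) ρ ≤ 2 * √((∑ a, ρ a).trace.re ^ 2
      - ((∑ a, ρ a).trace.re - avgFailureProb p h M Ψ) ^ 2) := by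
  set t : ℝ := (∑ a, ρ a).trace.re
  choose V W hV hW hVW using fun i => hΨ.exists_purifications_pecState (hg i) (hh i) (hM i)
  have h_norm : ∀ τ : G → Matrix (Bits m × E) (Bits m × E) ℂ, (∀ i, (τ i).trace.re = t) →
      (publicMixture p τ).trace.re = t := fun τ hτ => by
    simp only [re_trace_publicMixture, hτ, ← Finset.sum_mul, hp.2, one_mul]
  have h_overlap : hsForm (mixturePurif p V) (mixturePurif p W) = t - avgFailureProb p h M Ψ := by
    rw [hsForm_apply, mixturePurif_mul_conjTranspose hp.1, re_trace_publicMixture]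
    simp only [← hsForm_apply, hVW, mul_sub, Finset.sum_sub_distrib, ← Finset.sum_mul, hp.2,
      one_mul, avgFailureProb, t]
  have h_bound := traceNorm_mul_conjTranspose_sub_le (t := t) (mixturePurif p V) (mixturePurif p W)
    (by rw [hsForm_apply, mixturePurif_mul_conjTranspose hp.1]
        exact h_norm _ fun i => by rw [hV, trace_finalStateKE])
    (by rw [hsForm_apply, mixturePurif_mul_conjTranspose hp.1]
        exact h_norm _ fun i => by rw [hW, trace_idealStateKE])
  simpa only [secrecyDist, mixturePurif_mul_conjTranspose hp.1, hV, hW, h_overlap] using h_bound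

theorem IsPurification.secrecyDist_le (hρ : (∑ a, ρ a).trace.re ≤ 1)
    (hΨ : IsPurification Ψ (cqState ρ)) (hp : IsProbability p)
    (hg : ∀ i, Function.Surjective (g i)) (hh : ∀ i, IsCheckMatrix (g i) (h i))
    (hM : ∀ i, IsAncillaMeasurement (M i)) :
    secrecyDist p (fun i => ⇑(g i)) ρ ≤ 2 * √2 * √(avgFailureProb p h M Ψ) := by
  have h_trace_nonneg : 0 ≤ (∑ a, ρ a).trace.re :=
    (Complex.le_def.1 (Matrix.posSemidef_sum _ fun a _ => hΨ.posSemidef a).trace_nonneg).1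
  refine (hΨ.secrecyDist_le_two_mul_sqrt hp hg hh hM).trans ?_
  rw [mul_assoc, ← Real.sqrt_mul zero_le_two]
  gcongr 2 * ?_
  rcases le_total 0 (avgFailureProb p h M Ψ) with h_nonneg | h_nonpos
  · exact Real.sqrt_le_sqrt (by nlinarith)
  · rw [Real.sqrt_eq_zero_of_nonpos (by nlinarith)]
    positivity

end SecrecyBound

section Decoder

variable {n m : ℕ} {E A' : Type*} {f : Bits n → Matrix E A' ℂ} {ρ : Bits n → Matrix E E ℂ}

/-- The component `∑_{g a = k} (-1)^{e·a} ⟨a|_A Ψ` of the vector with blocks `f a = ⟨a|_A Ψ`: up to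
a scalar, what remains of it when the phase is `e` and the hash value is `k`. -/
def hashBlock (g : Bits n → Bits m) (f : Bits n → Matrix E A' ℂ) (e : Bits n) (k : Bits m) :
    Matrix E A' ℂ :=
  ∑ a with g a = k, sgn (e ⬝ᵥ a) • f a

lemma contract_star_phaseKet_eq_sum_hashBlock (g : Bits n → Bits m) (f : Bits n → Matrix E A' ℂ)
    (e : Bits n) :
    contract (star (phaseKet e)) f = (√(2 ^ n))⁻¹ • ∑ k, hashBlock g f e k := by
  simp only [hashBlock, Finset.sum_fiberwise, contract, Finset.smul_sum]
  refine Finset.sum_congr rfl fun a _ => ?_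
  simp [phaseKet, star_sgn, mul_smul, ← Complex.coe_smul]

lemma hashBlock_add_vecMul (g : Bits n →ₗ[ZMod 2] Bits m) (f : Bits n → Matrix E A' ℂ)
    (z : Bits n) (u k : Bits m) :
    hashBlock g f (z + u ᵥ* LinearMap.toMatrix' g) k = sgn (u ⬝ᵥ k) • hashBlock g f z k := by
  rw [hashBlock, hashBlock, Finset.smul_sum]
  refine Finset.sum_congr rfl fun a ha => ?_
  rw [add_dotProduct, vecMul_toMatrix'_dotProduct, (Finset.mem_filter.1 ha).2, sgn_add, mul_comm,
    mul_smul]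

lemma hashBlock_mul_conjTranspose [Fintype A'] (g : Bits n → Bits m)
    (hf : ∀ a b, f a * (f b)ᴴ = if a = b then ρ a else 0) (e : Bits n) (k l : Bits m) :
    hashBlock g f e k * (hashBlock g f e l)ᴴ = if k = l then ∑ a with g a = k, ρ a else 0 := by
  have h_contract : ∀ k, hashBlock g f e k
      = contract (fun a => if g a = k then sgn (e ⬝ᵥ a) else 0) f := fun k => by
    simp only [hashBlock, contract, ite_smul, zero_smul, Finset.sum_filter]
  rw [h_contract, h_contract, contract_mul_conjTranspose_of_orthogonal hf]
  rcases eq_or_ne k l with rfl | hkl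
  · rw [if_pos rfl, Finset.sum_filter]
    refine Finset.sum_congr rfl fun a _ => ?_
    split_ifs <;> simp [star_sgn, sgn_mul_self]
  · rw [if_neg hkl]
    refine Finset.sum_eq_zero fun a _ => ?_
    by_cases hk : g a = k <;> simp [hk, hkl]

lemma sum_sgn_mul_sgn_smul {M : Type*} [AddCommGroup M] [Module ℂ M] (T : Bits n → Bits n → M) :
    ∑ x : Bits n, ∑ a, ∑ b, (sgn (x ⬝ᵥ a) * sgn (x ⬝ᵥ b)) • T a b
      = (2 ^ n : ℂ) • ∑ a, T a a := by
  rw [Finset.sum_comm, Finset.smul_sum]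
  refine Finset.sum_congr rfl fun a _ => ?_
  rw [Finset.sum_comm]
  simp [← Finset.sum_smul, sum_sgn_dotProduct_mul_sgn_dotProduct]

variable [Fintype E]

/-- Decoding operators for the phase `e`, built from one operator `J k` for each hash value. -/
def phaseDecoder (g : Bits n → Bits m) (f : Bits n → Matrix E A' ℂ) (J : Bits m → Matrix E E ℂ)
    (e : Bits n) : Matrix A' E ℂ :=
  (√(2 ^ m))⁻¹ • ∑ k, (hashBlock g f e k)ᴴ * J k

lemma IsCheckMatrix.sum_coset_phaseDecoder {g : Bits n →ₗ[ZMod 2] Bits m}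
    {h : Matrix (Fin (n - m)) (Fin n) (ZMod 2)} (hh : IsCheckMatrix g h)
    (hg : Function.Surjective g) (f : Bits n → Matrix E A' ℂ) (J : Bits m → Matrix E E ℂ)
    (z : Bits n) :
    ∑ e with h *ᵥ e = h *ᵥ z, phaseDecoder g f J e * (phaseDecoder g f J e)ᴴ
      = ∑ k, (hashBlock g f z k)ᴴ * (J k * (J k)ᴴ) * hashBlock g f z k := by
  have h_sq : (√((2 : ℝ) ^ m))⁻¹ * (√(2 ^ m))⁻¹ = (2 ^ m)⁻¹ := by
    rw [← mul_inv, Real.mul_self_sqrt (by positivity)]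
  have h_expand : ∀ u : Bits m, phaseDecoder g f J (z + u ᵥ* LinearMap.toMatrix' g) *
      (phaseDecoder g f J (z + u ᵥ* LinearMap.toMatrix' g))ᴴ
      = ((2 : ℝ) ^ m)⁻¹ • ∑ k, ∑ l, (sgn (u ⬝ᵥ k) * sgn (u ⬝ᵥ l)) •
        ((hashBlock g f z k)ᴴ * (J k * (J l)ᴴ) * hashBlock g f z l) := fun u => by
    rw [phaseDecoder, Matrix.conjTranspose_smul, Matrix.smul_mul, Matrix.mul_smul, smul_smul,
      star_trivial, h_sq, Matrix.conjTranspose_sum, Matrix.sum_mul]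
    simp only [Matrix.mul_sum, hashBlock_add_vecMul, Matrix.conjTranspose_mul,
      Matrix.conjTranspose_smul, Matrix.conjTranspose_conjTranspose, star_sgn, Matrix.smul_mul,
      Matrix.mul_smul, smul_smul, Matrix.mul_assoc]
    simp only [mul_comm]
  rw [hh.sum_coset hg]
  simp only [h_expand, ← Finset.smul_sum, sum_sgn_mul_sgn_smul]
  simp [← Complex.coe_smul, smul_smul]

variable [Fintype A']

lemma contract_star_phaseKet_mul_phaseDecoder (g : Bits n → Bits m)
    (hf : ∀ a b, f a * (f b)ᴴ = if a = b then ρ a else 0) (J : Bits m → Matrix E E ℂ)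
    (e : Bits n) :
    contract (star (phaseKet e)) f * phaseDecoder g f J e
      = ((√(2 ^ n))⁻¹ * (√(2 ^ m))⁻¹) • ∑ k, (∑ a with g a = k, ρ a) * J k := by
  rw [contract_star_phaseKet_eq_sum_hashBlock g, phaseDecoder, Matrix.smul_mul, Matrix.mul_smul,
    smul_smul, Matrix.sum_mul]
  simp [Matrix.mul_sum, ← Matrix.mul_assoc, hashBlock_mul_conjTranspose g hf]

lemma sum_hsForm_contract_star_phaseKet_mul_phaseDecoder (g : Bits n → Bits m)
    (hf : ∀ a b, f a * (f b)ᴴ = if a = b then ρ a else 0) (J : Bits m → Matrix E E ℂ) :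
    ∑ e, hsForm (contract (star (phaseKet e)) f * phaseDecoder g f J e)
        (contract (star (phaseKet e)) f * phaseDecoder g f J e)
      = ((2 : ℝ) ^ m)⁻¹ * hsForm (∑ k, (∑ a with g a = k, ρ a) * J k)
          (∑ k, (∑ a with g a = k, ρ a) * J k) := by
  have h_card : (Fintype.card (Bits n) : ℝ) = 2 ^ n := by simp [ZMod.card]
  simp only [contract_star_phaseKet_mul_phaseDecoder g hf, map_smul, LinearMap.smul_apply,
    smul_eq_mul, Finset.sum_const, Finset.card_univ, nsmul_eq_mul, h_card]
  have h_sq : ∀ d : ℕ, (√((2 : ℝ) ^ d))⁻¹ * (√(2 ^ d))⁻¹ = (2 ^ d)⁻¹ := fun d => by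
    rw [← mul_inv, Real.mul_self_sqrt (by positivity)]
  linear_combination (hsForm (∑ k, (∑ a with g a = k, ρ a) * J k)
    (∑ k, (∑ a with g a = k, ρ a) * J k)) * (2 ^ n * (√((2 : ℝ) ^ m))⁻¹ ^ 2 * h_sq n + h_sq m
      + (√((2 : ℝ) ^ m))⁻¹ ^ 2 * mul_inv_cancel₀ (pow_ne_zero n (two_ne_zero' ℝ)))

lemma IsCheckMatrix.posSemidef_one_sub_sum_phaseDecoder [DecidableEq A']
    {g : Bits n →ₗ[ZMod 2] Bits m} {h : Matrix (Fin (n - m)) (Fin n) (ZMod 2)}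
    (hh : IsCheckMatrix g h) (hg : Function.Surjective g)
    (hf : ∀ a b, f a * (f b)ᴴ = if a = b then ρ a else 0) {J : Bits m → Matrix E E ℂ}
    (hJ : ∀ k, J k * (J k)ᴴ * (∑ a with g a = k, ρ a) * (J k * (J k)ᴴ) = J k * (J k)ᴴ)
    (s : Bits (n - m)) :
    (1 - ∑ e with h *ᵥ e = s, phaseDecoder g f J e * (phaseDecoder g f J e)ᴴ).PosSemidef := by
  by_cases hs : ∃ z, h *ᵥ z = s
  · obtain ⟨z, rfl⟩ := hs
    rw [hh.sum_coset_phaseDecoder hg, ← Matrix.nonneg_iff_posSemidef]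
    refine (IsStarProjection.one_sub ⟨?_, ?_⟩).nonneg
    · have h_term : ∀ k l, (hashBlock g f z k)ᴴ * (J k * (J k)ᴴ) * hashBlock g f z k *
          ((hashBlock g f z l)ᴴ * (J l * (J l)ᴴ) * hashBlock g f z l)
          = if k = l then (hashBlock g f z k)ᴴ * (J k * (J k)ᴴ) * hashBlock g f z k else 0 :=
        fun k l => by
          calc _ = (hashBlock g f z k)ᴴ * (J k * (J k)ᴴ *
                  (hashBlock g f z k * (hashBlock g f z l)ᴴ) * (J l * (J l)ᴴ)) *
                  hashBlock g f z l := by simp only [Matrix.mul_assoc]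
            _ = _ := by
                rw [hashBlock_mul_conjTranspose g hf]
                split_ifs with hkl
                · rw [← hkl, hJ]
                · simp
      simp [IsIdempotentElem, Matrix.sum_mul, Matrix.mul_sum, h_term]
    · simp [IsSelfAdjoint, Matrix.star_eq_conjTranspose, Matrix.mul_assoc]
  · simpa [not_exists.1 hs] using Matrix.PosSemidef.one

end Decoder

section AncillaMeasurement

variable {n m r : ℕ} {E A' : Type*} [Fintype E] [Fintype A']

lemma hsForm_mul_le_hsForm_mul {κ : Type*} [Fintype κ] {F : Matrix A' κ ℂ} {N : Matrix A' A' ℂ}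
    (hFN : F * Fᴴ ≤ N * Nᴴ) (y : Matrix E A' ℂ) :
    hsForm (y * F) (y * F) ≤ hsForm (y * N) (y * N) := by
  have h_nonneg : 0 ≤ (y * (N * Nᴴ - F * Fᴴ) * yᴴ).trace.re :=
    (Complex.le_def.1 ((Matrix.le_iff.1 hFN).mul_mul_conjTranspose_same y).trace_nonneg).1
  rw [Matrix.mul_sub, Matrix.sub_mul, Matrix.trace_sub, Complex.sub_re, sub_nonneg] at h_nonneg
  simpa only [hsForm_apply, Matrix.conjTranspose_mul, Matrix.mul_assoc] using h_nonneg

variable [DecidableEq A']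

/-- The effects that complete the decoder to a measurement are assigned to the outcome `0`. -/
lemma exists_isAncillaMeasurement_mul_conjTranspose_le (h : Matrix (Fin r) (Fin n) (ZMod 2))
    {F : Bits n → Matrix A' E ℂ} (hF : ∀ s, (1 - ∑ e with h *ᵥ e = s, F e * (F e)ᴴ).PosSemidef) :
    ∃ M : Bits r → Bits n → Matrix A' A' ℂ, IsAncillaMeasurement M ∧
      ∀ e, F e * (F e)ᴴ ≤ (M (h *ᵥ e) e)ᵀ * ((M (h *ᵥ e) e)ᵀ)ᴴ := by
  set rest : Bits r → Matrix A' A' ℂ := fun s => 1 - ∑ e with h *ᵥ e = s, F e * (F e)ᴴ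
  set P : Bits r → Bits n → Matrix A' A' ℂ := fun s e =>
    (if h *ᵥ e = s then F e * (F e)ᴴ else 0) + if e = 0 then rest s else 0
  have h_rest : ∀ s e, 0 ≤ if e = (0 : Bits n) then rest s else 0 := fun s e => by
    split_ifs
    exacts [(hF s).nonneg, le_rfl]
  have hP : ∀ s e, (P s e).PosSemidef := fun s e => by
    rw [← Matrix.nonneg_iff_posSemidef]
    refine add_nonneg ?_ (h_rest s e)
    split_ifs
    exacts [(Matrix.posSemidef_self_mul_conjTranspose _).nonneg, le_rfl]
  choose M hM using fun s e =>
    CStarAlgebra.nonneg_iff_eq_star_mul_self.1 (hP s e).transpose.nonneg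
  refine ⟨M, fun s => ?_, fun e => ?_⟩
  · have h_sum : ∑ e, P s e = 1 := by
      simp [P, rest, Finset.sum_add_distrib, Finset.sum_filter]
    simp only [← Matrix.star_eq_conjTranspose, ← hM, ← Matrix.transpose_sum, h_sum,
      Matrix.transpose_one]
  · calc F e * (F e)ᴴ ≤ P (h *ᵥ e) e := by simpa [P] using h_rest (h *ᵥ e) e
      _ = ((M (h *ᵥ e) e)ᴴ * M (h *ᵥ e) e)ᵀ := by
          rw [← Matrix.star_eq_conjTranspose, ← hM, Matrix.transpose_transpose]
      _ = _ := Matrix.transpose_mul _ _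

lemma IsPurification.exists_isAncillaMeasurement_phaseErrorProb_le [DecidableEq E]
    {ρ : Bits n → Matrix E E ℂ} {Ψ : (Bits n × E) × A' → ℂ} {g : Bits n →ₗ[ZMod 2] Bits m}
    {h : Matrix (Fin (n - m)) (Fin n) (ZMod 2)} (hΨ : IsPurification Ψ (cqState ρ))
    (hg : Function.Surjective g) (hh : IsCheckMatrix g h) {X : Bits m → Matrix E E ℂ}
    (hX : ∀ k, X k * (X k)ᴴ = ∑ a with g a = k, ρ a) :
    ∃ M : Bits (n - m) → Bits n → Matrix A' A' ℂ, IsAncillaMeasurement M ∧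
      phaseErrorProb (pecState h M Ψ)
        ≤ (∑ a, ρ a).trace.re - ((2 : ℝ) ^ m)⁻¹ * hsForm (∑ k, X k) (∑ k, X k) := by
  set J : Bits m → Matrix E E ℂ := fun k => pinv (∑ a with g a = k, ρ a) * X k with hJ
  have h_herm : ∀ k, (∑ a with g a = k, ρ a).IsHermitian := fun k =>
    hX k ▸ Matrix.isHermitian_mul_conjTranspose_self (X k)
  have h_effect : ∀ k, J k * (J k)ᴴ = pinv (∑ a with g a = k, ρ a) := fun k => by
    calc J k * (J k)ᴴ = pinv (∑ a with g a = k, ρ a) * (X k * (X k)ᴴ) *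
          (pinv (∑ a with g a = k, ρ a))ᴴ := by
          simp only [hJ, Matrix.conjTranspose_mul, Matrix.mul_assoc]
      _ = _ := by rw [hX, (isHermitian_pinv _).eq, pinv_mul_self_mul_pinv (h_herm k)]
  have h_decode : ∀ k, (∑ a with g a = k, ρ a) * J k = X k := fun k => by
    rw [hJ, ← Matrix.mul_assoc]
    exact mul_eq_of_mul_conjTranspose_le (mul_pinv_mul_self (h_herm k)) (hX k).le
  obtain ⟨M, hM, h_le⟩ := exists_isAncillaMeasurement_mul_conjTranspose_le h
    (hh.posSemidef_one_sub_sum_phaseDecoder hg hΨ.block_mul_conjTranspose (J := J) fun k => by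
      rw [h_effect, pinv_mul_self_mul_pinv (h_herm k)])
  refine ⟨M, hM, ?_⟩
  rw [hΨ.phaseErrorProb_pecState hg hh hM, sub_le_sub_iff_left]
  calc ((2 : ℝ) ^ m)⁻¹ * hsForm (∑ k, X k) (∑ k, X k)
      = ∑ e, hsForm (contract (star (phaseKet e)) (block Ψ) * phaseDecoder g (block Ψ) J e)
          (contract (star (phaseKet e)) (block Ψ) * phaseDecoder g (block Ψ) J e) := by
        simp only [sum_hsForm_contract_star_phaseKet_mul_phaseDecoder g
          hΨ.block_mul_conjTranspose, h_decode]
    _ ≤ _ := Finset.sum_le_sum fun e _ => hsForm_mul_le_hsForm_mul (h_le e) _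

end AncillaMeasurement

section CollisionBound

variable {ι E : Type*} [Fintype ι] [Fintype E] [DecidableEq E] {S : Matrix E E ℂ}

lemma exists_posSemidef_pow_four_eq {T : Matrix E E ℂ} (hT : T.PosSemidef) :
    ∃ S : Matrix E E ℂ, S.PosSemidef ∧ S ^ 4 = T :=
  ⟨CFC.sqrt (CFC.sqrt T), Matrix.nonneg_iff_posSemidef.1 (CFC.sqrt_nonneg _), by
    rw [show 4 = 2 * 2 from rfl, pow_mul, CFC.sq_sqrt _ (CFC.sqrt_nonneg T),
      CFC.sq_sqrt T hT.nonneg]⟩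

lemma three_re_trace_sq_mul_sq_le_of_pos {V : Matrix E E ℂ} (hS : S.PosSemidef)
    (hV : V.PosSemidef) {c : ℝ} (hc : 0 < c) :
    3 * (S ^ 2 * V ^ 2).trace.re
      ≤ 2 * (c * (S ^ 3 * V).trace.re) + (c ^ 2)⁻¹ * (V ^ 4).trace.re := by
  have h_scaled := three_re_trace_sq_mul_sq_le (hS.smul hc.le) hV
  simp only [smul_pow, Matrix.smul_mul, Matrix.trace_smul, Complex.smul_re,
    smul_eq_mul] at h_scaled
  refine le_of_mul_le_mul_left ?_ (pow_pos hc 2)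
  linear_combination h_scaled - (V ^ 4).trace.re * mul_inv_cancel₀ (pow_pos hc 2).ne'

lemma posSemidef_pinv_mul_mul_pinv (S : Matrix E E ℂ) {τ : Matrix E E ℂ} (hτ : τ.PosSemidef) :
    (pinv S * τ * pinv S).PosSemidef := by
  simpa only [(isHermitian_pinv S).eq] using hτ.mul_mul_conjTranspose_same (pinv S)

lemma exists_posSemidef_sq_eq (hS : S.PosSemidef) {τ : Matrix E E ℂ} (hτ : τ.PosSemidef)
    (hSτ : τ ≤ S ^ 4) :
    ∃ V : Matrix E E ℂ, V.PosSemidef ∧ V ^ 2 = pinv S * τ * pinv S ∧ S * V * (S * V)ᴴ = τ := by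
  have h_supp : S * pinv S * τ = τ :=
    mul_eq_of_posSemidef_of_le (by rw [pow_succ', ← Matrix.mul_assoc, mul_pinv_mul_self hS.1])
      hτ hSτ
  have h_supp' : τ * (pinv S * S) = τ := by
    have := congrArg Matrix.conjTranspose h_supp
    rwa [Matrix.conjTranspose_mul, Matrix.conjTranspose_mul, hτ.1.eq, hS.1.eq,
      (isHermitian_pinv S).eq] at this
  have h_sq : CFC.sqrt (pinv S * τ * pinv S) * CFC.sqrt (pinv S * τ * pinv S)
      = pinv S * τ * pinv S :=
      CFC.sqrt_mul_sqrt_self _ (posSemidef_pinv_mul_mul_pinv S hτ).nonneg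
  have hV : (CFC.sqrt (pinv S * τ * pinv S)).PosSemidef :=
    Matrix.nonneg_iff_posSemidef.1 (CFC.sqrt_nonneg _)
  refine ⟨_, hV, by rw [sq, h_sq], ?_⟩
  calc _ = S * (CFC.sqrt (pinv S * τ * pinv S) * CFC.sqrt (pinv S * τ * pinv S)) * S := by
        rw [Matrix.conjTranspose_mul, hS.1.eq, hV.1.eq]
        simp only [Matrix.mul_assoc]
    _ = S * pinv S * τ * (pinv S * S) := by
        rw [h_sq]
        simp only [Matrix.mul_assoc]
    _ = τ := by rw [h_supp, h_supp']

/-- The witnesses are `X k = S √(S⁻¹ τ_k S⁻¹)`, with `S⁻¹` the Moore–Penrose inverse, and the bound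
combines `three_re_trace_sq_mul_sq_le_of_pos` with `0 ≤ ‖c ∑ k, X k - S²‖²`. -/
lemma exists_factorization_trace_sub_le {τ : ι → Matrix E E ℂ} (hτ : ∀ k, (τ k).PosSemidef)
    (hS : S.PosSemidef) (hSτ : S ^ 4 = ∑ k, τ k) {c : ℝ} (hc : 0 < c) :
    ∃ X : ι → Matrix E E ℂ, (∀ k, X k * (X k)ᴴ = τ k) ∧
      (∑ k, τ k).trace.re - c ^ 2 * hsForm (∑ k, X k) (∑ k, X k)
        ≤ (c ^ 2)⁻¹ * ∑ k, hsForm (pinv S * τ k * pinv S) (pinv S * τ k * pinv S)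
          - (∑ k, τ k).trace.re := by
  have h_le : ∀ k, τ k ≤ S ^ 4 := fun k => by
    rw [hSτ]
    exact Finset.single_le_sum (fun l _ => (hτ l).nonneg) (Finset.mem_univ k)
  choose V hV hV_sq hSV using fun k => exists_posSemidef_sq_eq hS (hτ k) (h_le k)
  refine ⟨fun k => S * V k, hSV, ?_⟩
  have h_trace : (∑ k, τ k).trace.re = hsForm (S ^ 2) (S ^ 2) := by
    rw [hsForm_apply, (hS.1.pow 2).eq, ← pow_add, hSτ]
  have h_trace_term : ∀ k, (τ k).trace.re = (S ^ 2 * V k ^ 2).trace.re := fun k => by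
    rw [← hSV, Matrix.conjTranspose_mul, hS.1.eq, (hV k).1.eq, ← Matrix.mul_assoc,
      Matrix.trace_mul_comm]
    simp only [sq, Matrix.mul_assoc]
  have h_overlap : ∀ k, hsForm (S * V k) (S ^ 2) = (S ^ 3 * V k).trace.re := fun k => by
    rw [hsForm_apply, (hS.1.pow 2).eq, Matrix.trace_mul_comm, ← Matrix.mul_assoc, ← pow_succ]
  have h_collision : ∀ k, (V k ^ 4).trace.re
      = hsForm (pinv S * τ k * pinv S) (pinv S * τ k * pinv S) := fun k => by
    rw [← hV_sq, hsForm_apply, ((hV k).1.pow 2).eq, ← pow_add]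
  have h_term : ∀ k, 3 * (τ k).trace.re ≤ 2 * (c * hsForm (S * V k) (S ^ 2)) +
      (c ^ 2)⁻¹ * hsForm (pinv S * τ k * pinv S) (pinv S * τ k * pinv S) := fun k => by
    rw [h_trace_term, h_overlap, ← h_collision]
    exact three_re_trace_sq_mul_sq_le_of_pos hS (hV k) hc
  have h_cross : hsForm (∑ k, S * V k) (S ^ 2) = ∑ k, hsForm (S * V k) (S ^ 2) := by
    simp only [map_sum, LinearMap.sum_apply]
  have h_sum := Finset.sum_le_sum fun k (_ : k ∈ Finset.univ) => h_term k
  simp only [Finset.sum_add_distrib, ← Finset.mul_sum, ← Complex.re_sum,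
    ← Matrix.trace_sum] at h_sum
  have h_square := hsForm_self_nonneg (c • (∑ k, S * V k) - S ^ 2)
  rw [hsForm_sub_self, ← h_trace] at h_square
  simp only [map_smul, LinearMap.smul_apply, smul_eq_mul, h_cross] at h_square
  linarith

lemma hsForm_pinv_mul_mul_pinv_nonneg (S : Matrix E E ℂ) {τ τ' : Matrix E E ℂ}
    (hτ : τ.PosSemidef) (hτ' : τ'.PosSemidef) :
    0 ≤ hsForm (pinv S * τ * pinv S) (pinv S * τ' * pinv S) := by
  rw [hsForm_apply, (posSemidef_pinv_mul_mul_pinv S hτ').1.eq]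
  exact re_trace_mul_nonneg (posSemidef_pinv_mul_mul_pinv S hτ) (posSemidef_pinv_mul_mul_pinv S hτ')

lemma hsForm_pinv_mul_mul_pinv_le (S : Matrix E E ℂ) {τ σ : Matrix E E ℂ} (hτ : τ.PosSemidef)
    {c : ℝ} (hτσ : τ ≤ c • σ) :
    hsForm (pinv S * τ * pinv S) (pinv S * τ * pinv S)
      ≤ c * (pinv S * (pinv S * τ * pinv S) * pinv S * σ).trace.re := by
  calc hsForm (pinv S * τ * pinv S) (pinv S * τ * pinv S)
      = (pinv S * (pinv S * τ * pinv S) * pinv S * τ).trace.re := by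
        rw [hsForm_apply, (posSemidef_pinv_mul_mul_pinv S hτ).1.eq, ← Matrix.mul_assoc,
          Matrix.trace_mul_comm]
        simp only [Matrix.mul_assoc]
    _ ≤ (pinv S * (pinv S * τ * pinv S) * pinv S * (c • σ)).trace.re :=
        re_trace_mul_le_re_trace_mul
          (posSemidef_pinv_mul_mul_pinv S (posSemidef_pinv_mul_mul_pinv S hτ)) hτσ
    _ = _ := by rw [Matrix.mul_smul, Matrix.trace_smul, Complex.smul_re, smul_eq_mul]

lemma sum_pinv_mul_mul_pinv {τ : ι → Matrix E E ℂ} (hS : S.IsHermitian)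
    (hSτ : S ^ 4 = ∑ a, τ a) : ∑ a, pinv S * τ a * pinv S = S ^ 2 := by
  calc ∑ a, pinv S * τ a * pinv S = (pinv S * S) * (S * S) * (S * pinv S) := by
        rw [← Matrix.sum_mul, ← Matrix.mul_sum, ← hSτ]
        simp only [pow_succ, pow_zero, Matrix.one_mul, Matrix.mul_assoc]
    _ = (S * pinv S * S) * (S * pinv S * S) := by
        rw [← mul_pinv_comm hS]
        nth_rewrite 2 [mul_pinv_comm hS]
        simp only [Matrix.mul_assoc]
    _ = S ^ 2 := by rw [mul_pinv_mul_self hS, sq]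

lemma sum_hsForm_pinv_mul_mul_pinv {τ : ι → Matrix E E ℂ} (hS : S.IsHermitian)
    (hSτ : S ^ 4 = ∑ a, τ a) :
    ∑ a, ∑ b, hsForm (pinv S * τ a * pinv S) (pinv S * τ b * pinv S)
      = (∑ a, τ a).trace.re := by
  calc _ = hsForm (S ^ 2) (S ^ 2) := by
        simp only [← sum_pinv_mul_mul_pinv hS hSτ, map_sum, LinearMap.sum_apply]
        exact Finset.sum_comm
    _ = _ := by rw [hsForm_apply, (hS.pow 2).eq, ← pow_add, hSτ]

lemma sum_hsForm_pinv_mul_mul_pinv_self_le {τ : ι → Matrix E E ℂ} (hτ : ∀ a, (τ a).PosSemidef)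
    (hS : S.IsHermitian) (hSτ : S ^ 4 = ∑ a, τ a) {σ : Matrix E E ℂ} (hσ : σ.PosSemidef) {c : ℝ}
    (hc : 0 ≤ c) (hτσ : ∀ a, τ a ≤ c • σ) :
    ∑ a, hsForm (pinv S * τ a * pinv S) (pinv S * τ a * pinv S) ≤ c * σ.trace.re := by
  have h_idem : IsIdempotentElem (S * pinv S) := by
    rw [IsIdempotentElem, ← Matrix.mul_assoc, mul_pinv_mul_self hS]
  have h_support : ∑ a, pinv S * (pinv S * τ a * pinv S) * pinv S = S * pinv S := by
    rw [← Matrix.sum_mul, ← Matrix.mul_sum, sum_pinv_mul_mul_pinv hS hSτ, sq, ← Matrix.mul_assoc,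
      ← mul_pinv_comm hS, Matrix.mul_assoc, h_idem]
  have h_self : IsSelfAdjoint (S * pinv S) := by
    rw [IsSelfAdjoint, Matrix.star_eq_conjTranspose, Matrix.conjTranspose_mul, hS.eq,
      (isHermitian_pinv S).eq, mul_pinv_comm hS]
  have h_le_one : S * pinv S ≤ 1 :=
    sub_nonneg.1 (IsStarProjection.one_sub ⟨h_idem, h_self⟩).nonneg
  calc ∑ a, hsForm (pinv S * τ a * pinv S) (pinv S * τ a * pinv S)
      ≤ ∑ a, c * (pinv S * (pinv S * τ a * pinv S) * pinv S * σ).trace.re :=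
        Finset.sum_le_sum fun a _ => hsForm_pinv_mul_mul_pinv_le S (hτ a) (hτσ a)
    _ = c * (σ * (S * pinv S)).trace.re := by
        rw [← Finset.mul_sum, ← Complex.re_sum, ← Matrix.trace_sum, ← Matrix.sum_mul, h_support,
          Matrix.trace_mul_comm]
    _ ≤ c * (σ * 1).trace.re :=
        mul_le_mul_of_nonneg_left (re_trace_mul_le_re_trace_mul hσ h_le_one) hc
    _ = c * σ.trace.re := by rw [Matrix.mul_one]

end CollisionBound

section UniversalHashing

variable {n m : ℕ} {E G : Type*}

lemma sum_hsForm_sum_fiber [Fintype E] {ι κ : Type*} [Fintype ι] [Fintype κ] [DecidableEq κ]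
    (w : ι → κ) (Y : ι → Matrix E E ℂ) :
    ∑ k, hsForm (∑ a with w a = k, Y a) (∑ a with w a = k, Y a)
      = ∑ a, ∑ b, if w a = w b then hsForm (Y a) (Y b) else 0 := by
  rw [← Finset.sum_fiberwise Finset.univ w]
  refine Finset.sum_congr rfl fun k _ => ?_
  simp only [map_sum, LinearMap.sum_apply]
  rw [Finset.sum_comm]
  refine Finset.sum_congr rfl fun a ha => ?_
  rw [Finset.sum_filter]
  refine Finset.sum_congr rfl fun b _ => ?_
  simp only [(Finset.mem_filter.1 ha).2, eq_comm]

variable [Fintype G] {p : G → ℝ}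

lemma IsUniversal2.sum_mul_sum_collision_le {g : G → Bits n → Bits m} (hu : IsUniversal2 p g)
    (hp : IsProbability p) {q : Bits n → Bits n → ℝ} (hq : ∀ a b, 0 ≤ q a b) :
    ∑ i, p i * ∑ a, ∑ b, (if g i a = g i b then q a b else 0)
      ≤ ∑ a, q a a + ((2 : ℝ) ^ m)⁻¹ * ∑ a, ∑ b, q a b := by
  have h_swap : ∑ i, p i * ∑ a, ∑ b, (if g i a = g i b then q a b else 0)
      = ∑ a, ∑ b, (∑ i with g i a = g i b, p i) * q a b := by
    simp only [Finset.mul_sum, Finset.sum_mul, Finset.sum_filter, mul_ite, ite_mul, mul_zero,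
      zero_mul]
    rw [Finset.sum_comm]
    exact Finset.sum_congr rfl fun a _ => Finset.sum_comm
  have h_pair : ∀ a b, (∑ i with g i a = g i b, p i) * q a b
      ≤ (if a = b then q a b else 0) + ((2 : ℝ) ^ m)⁻¹ * q a b := fun a b => by
    split_ifs with hab
    · subst hab
      have := mul_nonneg (inv_nonneg.2 (pow_nonneg zero_le_two m)) (hq a a)
      simpa [hp.2] using this
    · simpa using mul_le_mul_of_nonneg_right (hu a b hab) (hq a b)
  rw [h_swap]
  refine (Finset.sum_le_sum fun a _ => Finset.sum_le_sum fun b _ => h_pair a b).trans_eq ?_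
  simp [Finset.sum_add_distrib, Finset.mul_sum]

end UniversalHashing

section MinEntropy

variable {n : ℕ} {E : Type*} {ρ : Bits n → Matrix E E ℂ}

lemma le_of_cqState_le {σ : Matrix E E ℂ} {c : ℝ}
    (h : cqState ρ ≤ (c : ℂ) • ((1 : Matrix (Bits n) (Bits n) ℂ) ⊗ₖ σ)) (a : Bits n) :
    ρ a ≤ c • σ := by
  have h_block : c • σ - ρ a
      = ((c : ℂ) • ((1 : Matrix (Bits n) (Bits n) ℂ) ⊗ₖ σ) - cqState ρ).submatrix
        (fun ε => (a, ε)) fun ε => (a, ε) := by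
    ext ε ε'
    simp [cqState_apply]
  rw [Matrix.le_iff, h_block]
  exact (Matrix.le_iff.1 h).submatrix _

lemma minEntropySet_cqState_nonempty [Fintype E] (hρ : ∀ a, (ρ a).PosSemidef)
    (hρ0 : cqState ρ ≠ 0) :
    (minEntropySet (cqState ρ)).Nonempty := by
  have hE : (∑ a, ρ a).PosSemidef := Matrix.posSemidef_sum _ fun a _ => hρ a
  obtain ⟨t, ht⟩ : ∃ t : ℝ, (∑ a, ρ a).trace = t :=
    ⟨_, Complex.ext rfl (Complex.le_def.1 hE.trace_nonneg).2.symm⟩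
  have h_pos : 0 < t := by
    have h_nonneg := hE.trace_nonneg
    rw [ht, Complex.zero_le_real] at h_nonneg
    refine h_nonneg.lt_of_ne' fun h_zero => hρ0 ?_
    have h_sum : ∑ a, ρ a = 0 := hE.trace_eq_zero_iff.1 (by rw [ht, h_zero, Complex.ofReal_zero])
    have h_blocks : ∀ a, ρ a = 0 := fun a =>
      (Finset.sum_eq_zero_iff_of_nonneg fun b _ => (hρ b).nonneg).1 h_sum a (Finset.mem_univ a)
    simp [cqState, h_blocks]
  have h_ne : (t : ℂ) ≠ 0 := by exact_mod_cast h_pos.ne'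
  refine ⟨-Real.logb 2 t, (t : ℂ)⁻¹ • ∑ a, ρ a, ?_, ?_, ?_⟩
  · exact hE.smul (by rw [← Complex.ofReal_inv]; exact_mod_cast (inv_pos.2 h_pos).le)
  · rw [Matrix.trace_smul, ht, smul_eq_mul, inv_mul_cancel₀ h_ne]
  · rw [neg_neg, Real.rpow_logb (by norm_num) (by norm_num) h_pos, Matrix.kronecker_smul, smul_smul,
      mul_inv_cancel₀ h_ne, one_smul, Matrix.le_iff]
    have h_compl : (1 : Matrix (Bits n) (Bits n) ℂ) ⊗ₖ (∑ a, ρ a) - cqState ρ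
        = cqState fun a => ∑ b with b ≠ a, ρ b := by
      ext ⟨a, ε⟩ ⟨b, ε'⟩
      rw [Matrix.sub_apply, cqState_apply, cqState_apply, Matrix.kroneckerMap_apply,
        Matrix.one_apply]
      split_ifs with hab
      · rw [one_mul, ← Matrix.sub_apply, Finset.filter_ne', ← Finset.sum_erase_eq_sub (by simp)]
      · simp
    rw [h_compl]
    refine Matrix.posSemidef_sum _ fun a _ => Matrix.PosSemidef.kronecker ?_
      (Matrix.posSemidef_sum _ fun b _ => hρ b)
    have := Matrix.posSemidef_self_mul_conjTranspose (proj a : Matrix (Bits n) (Bits n) ℂ)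
    simpa [proj] using this

lemma le_rpow_sub_condMinEntropy [Fintype E] {A : Type*} [Fintype A] [DecidableEq A]
    {τ : Matrix (A × E) (A × E) ℂ} (hτ : (minEntropySet τ).Nonempty) {x c : ℝ}
    (hx : ∀ r ∈ minEntropySet τ, x ≤ (2 : ℝ) ^ (c - r)) :
    x ≤ (2 : ℝ) ^ (c - condMinEntropy τ) := by
  rcases le_or_gt x 0 with h_nonpos | h_pos
  · exact h_nonpos.trans (by positivity)
  · rw [← Real.logb_le_iff_le_rpow one_lt_two h_pos, le_sub_comm]
    exact csSup_le hτ fun r hr =>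
      le_sub_comm.1 ((Real.logb_le_iff_le_rpow one_lt_two h_pos).2 (hx r hr))

end MinEntropy

section DirectPart

variable {n m : ℕ} {E A' G : Type*} [Fintype E] [DecidableEq E] [Fintype A'] [DecidableEq A']
  [Fintype G] {ρ : Bits n → Matrix E E ℂ} {Ψ : (Bits n × E) × A' → ℂ}

lemma IsPurification.exists_isAncillaMeasurement_phaseErrorProb_le_collision
    (hΨ : IsPurification Ψ (cqState ρ)) {g : Bits n →ₗ[ZMod 2] Bits m}
    {h : Matrix (Fin (n - m)) (Fin n) (ZMod 2)} (hg : Function.Surjective g)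
    (hh : IsCheckMatrix g h) {S : Matrix E E ℂ} (hS : S.PosSemidef) (hSρ : S ^ 4 = ∑ a, ρ a) :
    ∃ M : Bits (n - m) → Bits n → Matrix A' A' ℂ, IsAncillaMeasurement M ∧
      phaseErrorProb (pecState h M Ψ) ≤ (2 : ℝ) ^ m *
        (∑ a, ∑ b, if g a = g b then hsForm (pinv S * ρ a * pinv S) (pinv S * ρ b * pinv S) else 0)
          - (∑ a, ρ a).trace.re := by
  have h_fiber : ∑ k, ∑ a with g a = k, ρ a = ∑ a, ρ a := Finset.sum_fiberwise _ g ρ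
  have h_sq : (√((2 : ℝ) ^ m))⁻¹ ^ 2 = ((2 : ℝ) ^ m)⁻¹ := by
    rw [inv_pow, Real.sq_sqrt (by positivity)]
  obtain ⟨X, hX, h_bound⟩ := exists_factorization_trace_sub_le
    (fun k => Matrix.posSemidef_sum {a | g a = k} fun a _ => hΨ.posSemidef a) hS
    (hSρ.trans h_fiber.symm) (c := (√((2 : ℝ) ^ m))⁻¹) (by positivity)
  obtain ⟨M, hM, h_error⟩ := hΨ.exists_isAncillaMeasurement_phaseErrorProb_le hg hh hX
  refine ⟨M, hM, h_error.trans ?_⟩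
  rw [← sum_hsForm_sum_fiber]
  simpa only [h_fiber, h_sq, inv_inv, Matrix.mul_sum, Matrix.sum_mul] using h_bound

theorem IsPurification.exists_isAncillaMeasurement_avgFailureProb_le
    (hΨ : IsPurification Ψ (cqState ρ)) {p : G → ℝ} (hp : IsProbability p)
    {g : G → Bits n →ₗ[ZMod 2] Bits m} (hg : ∀ i, Function.Surjective (g i))
    (hu : IsUniversal2 p fun i => ⇑(g i)) {h : G → Matrix (Fin (n - m)) (Fin n) (ZMod 2)}
    (hh : ∀ i, IsCheckMatrix (g i) (h i)) :
    ∃ M : G → Bits (n - m) → Bits n → Matrix A' A' ℂ, (∀ i, IsAncillaMeasurement (M i)) ∧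
      ∀ r ∈ minEntropySet (cqState ρ), avgFailureProb p h M Ψ ≤ (2 : ℝ) ^ ((m : ℝ) - r) := by
  obtain ⟨S, hS, hSρ⟩ := exists_posSemidef_pow_four_eq
    (Matrix.posSemidef_sum Finset.univ fun a _ => hΨ.posSemidef a)
  set q : Bits n → Bits n → ℝ := fun a b => hsForm (pinv S * ρ a * pinv S) (pinv S * ρ b * pinv S)
  set t : ℝ := (∑ a, ρ a).trace.re
  choose M hM h_error using fun i =>
    hΨ.exists_isAncillaMeasurement_phaseErrorProb_le_collision (hg i) (hh i) hS hSρ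
  refine ⟨M, hM, fun r ⟨σ, hσ, hσ_trace, hσρ⟩ => ?_⟩
  have h_collision : ∑ i, p i * ∑ a, ∑ b, (if g i a = g i b then q a b else 0)
      ≤ ∑ a, q a a + ((2 : ℝ) ^ m)⁻¹ * t := by
    simp only [t, ← sum_hsForm_pinv_mul_mul_pinv hS.1 hSρ]
    exact hu.sum_mul_sum_collision_le hp fun a b =>
      hsForm_pinv_mul_mul_pinv_nonneg S (hΨ.posSemidef a) (hΨ.posSemidef b)
  have h_diagonal : ∑ a, q a a ≤ (2 : ℝ) ^ (-r) := by
    simpa [hσ_trace] using sum_hsForm_pinv_mul_mul_pinv_self_le hΨ.posSemidef hS.1 hSρ hσ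
      (Real.rpow_nonneg zero_le_two (-r)) (le_of_cqState_le hσρ)
  calc avgFailureProb p h M Ψ
      ≤ ∑ i, p i * ((2 : ℝ) ^ m * (∑ a, ∑ b, if g i a = g i b then q a b else 0) - t) :=
        Finset.sum_le_sum fun i _ => mul_le_mul_of_nonneg_left (h_error i) (hp.1 i)
    _ = (2 : ℝ) ^ m * (∑ i, p i * ∑ a, ∑ b, if g i a = g i b then q a b else 0) - t := by
        simp only [mul_sub, Finset.sum_sub_distrib, ← Finset.sum_mul, hp.2, one_mul,
          mul_left_comm (p _), ← Finset.mul_sum]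
    _ ≤ (2 : ℝ) ^ m * (∑ a, q a a + ((2 : ℝ) ^ m)⁻¹ * t) - t := by gcongr
    _ = (2 : ℝ) ^ m * ∑ a, q a a := by
        rw [mul_add, mul_inv_cancel_left₀ (by positivity), add_sub_cancel_right]
    _ ≤ (2 : ℝ) ^ m * (2 : ℝ) ^ (-r) := by gcongr
    _ = (2 : ℝ) ^ ((m : ℝ) - r) := by
        rw [sub_eq_add_neg, Real.rpow_add zero_lt_two, Real.rpow_natCast]

end DirectPart

section Exponents

lemma sqrt_le_two_rpow_half_mul {x y : ℝ} (h : x ≤ (2 : ℝ) ^ y) :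
    √x ≤ (2 : ℝ) ^ ((1 / 2 : ℝ) * y) := by
  rw [mul_comm, Real.rpow_mul zero_le_two, ← Real.sqrt_eq_rpow]
  exact Real.sqrt_le_sqrt h

lemma two_mul_sqrt_two_mul_two_rpow_half (x : ℝ) :
    2 * √2 * (2 : ℝ) ^ ((1 / 2 : ℝ) * x) = (2 : ℝ) ^ ((1 / 2 : ℝ) * (x + 3)) := by
  rw [mul_add, Real.rpow_add zero_lt_two, mul_comm, Real.sqrt_eq_rpow,
    ← Real.rpow_one_add' zero_le_two (by norm_num)]
  norm_num

end Exponents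

end PhaseEC

end

theorem mainTheorem2 {n m : ℕ} {E A' G : Type*} [Fintype E] [DecidableEq E]
    [Fintype A'] [DecidableEq A'] [Fintype G] [DecidableEq G]
    (ρ : PhaseEC.Bits n → Matrix E E ℂ) (hρ : PhaseEC.IsSubnormalizedCQ ρ)
    (hρ0 : PhaseEC.cqState ρ ≠ 0)
    (Ψ : (PhaseEC.Bits n × E) × A' → ℂ) (hΨ : PhaseEC.IsPurification Ψ (PhaseEC.cqState ρ))
    (p : G → ℝ) (hp : PhaseEC.IsProbability p)
    (g : G → PhaseEC.Bits n →ₗ[ZMod 2] PhaseEC.Bits m)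
    (hg : ∀ i, Function.Surjective (g i))
    (hu : PhaseEC.IsUniversal2 p (fun i => ⇑(g i)))
    (h : G → Matrix (Fin (n - m)) (Fin n) (ZMod 2))
    (hh : ∀ i, PhaseEC.IsCheckMatrix (g i) (h i)) :
    (∀ M : G → PhaseEC.Bits (n - m) → PhaseEC.Bits n → Matrix A' A' ℂ,
      (∀ i, PhaseEC.IsAncillaMeasurement (M i)) →
        PhaseEC.secrecyDist p (fun i => ⇑(g i)) ρ ≤
          2 * √2 * √(PhaseEC.avgFailureProb p h M Ψ)) ∧
    ∃ M : G → PhaseEC.Bits (n - m) → PhaseEC.Bits n → Matrix A' A' ℂ,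
      (∀ i, PhaseEC.IsAncillaMeasurement (M i)) ∧
      PhaseEC.secrecyDist p (fun i => ⇑(g i)) ρ ≤
        2 * √2 * √(PhaseEC.avgFailureProb p h M Ψ) ∧
      2 * √2 * √(PhaseEC.avgFailureProb p h M Ψ) ≤
        2 * √2 * (2 : ℝ) ^ ((1 / 2 : ℝ) *
          ((m : ℝ) - PhaseEC.condMinEntropy (PhaseEC.cqState ρ))) ∧
      2 * √2 * (2 : ℝ) ^ ((1 / 2 : ℝ) *
          ((m : ℝ) - PhaseEC.condMinEntropy (PhaseEC.cqState ρ))) =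
        (2 : ℝ) ^ ((1 / 2 : ℝ) *
          ((m : ℝ) - PhaseEC.condMinEntropy (PhaseEC.cqState ρ) + 3)) := by
  have h_trace : (∑ a, ρ a).trace.re ≤ 1 := by simpa only [Matrix.trace_sum] using hρ.2
  have h_secrecy := fun M => hΨ.secrecyDist_le (M := M) h_trace hp hg hh
  obtain ⟨M, hM, h_error⟩ := hΨ.exists_isAncillaMeasurement_avgFailureProb_le hp hg hu hh
  have h_entropy := PhaseEC.le_rpow_sub_condMinEntropy
    (PhaseEC.minEntropySet_cqState_nonempty hρ.1 hρ0) h_error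
  refine ⟨h_secrecy, M, hM, h_secrecy M hM, ?_, PhaseEC.two_mul_sqrt_two_mul_two_rpow_half _⟩
  exact mul_le_mul_of_nonneg_left (PhaseEC.sqrt_le_two_rpow_half_mul h_entropy) (by positivity)
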